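/- Let $\Sigma$ be a fan in $\mathbb R^n$, i.e. a finite collection of strongly convex rational polyhedral cones, closed under passing to faces, such that any two of its cones intersect in a common face, and suppose $\{\mathbf 0\}\subsetneq\Sigma$. Let $\rho_1,\dots,\rho_r$ be the distinct one-dimensional cones of $\Sigma$, and let $\mathbf n_k\in\mathbb Z^n$ be the primitive generator of $\rho_k$, so that $\rho_k\cap\mathbb Z^n=\mathbb Z_{\ge0}\,\mathbf n_k$. Let $\mathcal K_\Sigma$ be the underlying simplicial complex of $\Sigma$: the simplicial complex on $[r]=\{1,\dots,r\}$ (containing $\emptyset$) generated by the sets $J\subset[r]$ such that $\{\mathbf n_j\}_{j\in J}$ spans a cone in $\Sigma$. (If $\Sigma$ is simplicial, the simplices of $\mathcal K_\Sigma$ are exactly these sets $J$.) For a space $X$ let $\mathrm{SP}^d(X)=X^d/S_d$ be its $d$-th symmetric product, whose points are regarded as multisets of $d$ points of $X$. Let $D=(d_1,\dots,d_r)$ be an $r$-tuple of integers $d_i\ge1$. Put $$E^\Sigma_D(X)=\Big\{(\xi_1,\dots,\xi_r)\in\prod_{i=1}^r\mathrm{SP}^{d_i}(X)\ :\ \bigcap_{i\in\sigma}\xi_i=\emptyset\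 \text{ for every }\sigma\subset[r]\text{ with }\sigma\notin\mathcal K_\Sigma\Big\}$$ with the subspace topology. For a closed subset $A\subset X$ let $E^\Sigma_D(X,A)$ be the quotient space of $E^\Sigma_D(X)$ by the relation $(\xi_i)\sim(\eta_i)$ if $\xi_i\cap(X\setminus A)=\eta_i\cap(X\setminus A)$, with multiplicities, for every $i$. Let $U=\{w\in\mathbb C:|w|<1\}$, and let $$E^\Sigma(\overline U,\partial\overline U)=\bigcup_{k\ge0}E^\Sigma_{D(k)}(\overline U,\partial\overline U),\qquad D(k)=(d_1+k,\dots,d_r+k),$$ be the union along the inclusions given by adding points of $\partial\overline U$, with the colimit topology. Finally let $DJ(\mathcal K_\Sigma)=\bigcup_{\sigma\in\mathcal K_\Sigma}\{(x_1,\dots,x_r)\in(\mathbb C\mathrm P^\infty)^r: x_k=*\text{ for all }k\notin\sigma\}$ be the Davis–Januszkiewicz space of $\mathcal K_\Sigma$, a subspace of $(\mathbb C\mathrm P^\infty)^r$, where $\mathbb C\mathrm P^\infty=\bigcup_N\mathbb C\mathrm P^N$ has the colimit topology and $*$ is a base point. Then, for every such $D$, there is a homotopy equivalence $E^\Sigma(\overline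 U,\partial\overline U)\simeq DJ(\mathcal K_\Sigma)$. -/

import Mathlib

noncomputable section

/-! ### Fans and their underlying simplicial complexes -/

/-- The vector of `ℝⁿ` given by a vector of the lattice `ℤⁿ`. -/
def latticeVec {n : ℕ} (m : Fin n → ℤ) : Fin n → ℝ := fun j => (m j : ℝ)

/-- `Cone(m_i : i ∈ I)`: all nonnegative real combinations of the lattice vectors `m_i`, `i ∈ I`. -/
def latticeCone {ι : Type*} {n : ℕ} (m : ι → Fin n → ℤ) (I : Finset ι) :
    PointedCone ℝ (Fin n → ℝ) :=
  PointedCone.hull ℝ ((fun i => latticeVec (m i)) '' (I : Set ι))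

/-- A convex rational polyhedral cone in `ℝⁿ`: a cone generated by a finite set of lattice
vectors. -/
def IsRationalPolyhedral {n : ℕ} (σ : PointedCone ℝ (Fin n → ℝ)) : Prop :=
  ∃ S : Finset (Fin n → ℤ), σ = latticeCone id S

/-- `σ ∩ (-σ) = {0}`. -/
def IsStronglyConvex {n : ℕ} (σ : PointedCone ℝ (Fin n → ℝ)) : Prop :=
  ∀ x, x ∈ σ → -x ∈ σ → x = 0

/-- `τ` is a face of `σ`: there is a linear form `L`, nonnegative on `σ`, such that
`τ = σ ∩ {L = 0}`. -/
def IsConeFace {n : ℕ} (τ σ : PointedCone ℝ (Fin n → ℝ)) : Prop :=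
  ∃ L : (Fin n → ℝ) →ₗ[ℝ] ℝ, (∀ x ∈ σ, 0 ≤ L x) ∧ ∀ x, x ∈ τ ↔ x ∈ σ ∧ L x = 0

/-- The dimension of a cone: the dimension of the smallest linear subspace containing it. -/
def coneDim {n : ℕ} (σ : PointedCone ℝ (Fin n → ℝ)) : ℕ :=
  Module.finrank ℝ (Submodule.span ℝ (σ : Set (Fin n → ℝ)))

/-- A fan in `ℝⁿ`: a finite collection of strongly convex rational polyhedral cones, closed under
passing to faces, in which any two members meet in a common face. -/
structure ConeFan (n : ℕ) where
  cones : Set (PointedCone ℝ (Fin n → ℝ))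
  finite_cones : cones.Finite
  rational : ∀ σ ∈ cones, IsRationalPolyhedral σ
  stronglyConvex : ∀ σ ∈ cones, IsStronglyConvex σ
  face_mem : ∀ σ ∈ cones, ∀ τ, IsConeFace τ σ → τ ∈ cones
  inter_face : ∀ σ ∈ cones, ∀ τ ∈ cones, IsConeFace (σ ⊓ τ) σ ∧ IsConeFace (σ ⊓ τ) τ

/-- `Σ(1)`: the one dimensional cones of a fan. -/
def ConeFan.rays {n : ℕ} (F : ConeFan n) : Set (PointedCone ℝ (Fin n → ℝ)) :=
  {ρ | ρ ∈ F.cones ∧ coneDim ρ = 1}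

/-- `ν` is the primitive generator of `ρ`: `ρ ∩ ℤⁿ = ℤ_{≥ 0} ν`. -/
def IsPrimitiveGenerator {n : ℕ} (ν : Fin n → ℤ) (ρ : PointedCone ℝ (Fin n → ℝ)) : Prop :=
  ∀ m : Fin n → ℤ, latticeVec m ∈ ρ ↔ ∃ k : ℕ, m = k • ν

/-- The sets `J` of indices such that the vectors `ν_j`, `j ∈ J`, span a cone in the fan. -/
def ConeFan.spanningSets {n r : ℕ} (F : ConeFan n) (ν : Fin r → Fin n → ℤ) :
    Set (Finset (Fin r)) :=
  {J | latticeCone ν J ∈ F.cones}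

/-- The underlying simplicial complex of a fan with primitive generators `ν_1, …, ν_r`: the
simplicial complex on the vertex set `Fin r` generated by the sets `J` such that the `ν_j`, `j ∈ J`,
span a cone in the fan. (The empty set counts as a simplex.) -/
def ConeFan.underlyingComplex {n r : ℕ} (F : ConeFan n) (ν : Fin r → Fin n → ℤ) :
    Set (Finset (Fin r)) :=
  {I | ∃ J, I ⊆ J ∧ J ∈ F.spanningSets ν}

/-- The underlying simplicial complex is closed under passing to subsets. -/
theorem ConeFan.isLowerSet_underlyingComplex {n r : ℕ} (F : ConeFan n)
    (ν : Fin r → Fin n → ℤ) : IsLowerSet (F.underlyingComplex ν) := by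
  rintro I I' h ⟨J, hIJ, hJ⟩
  exact ⟨J, h.trans hIJ, hJ⟩

/-- Whenever the sets `J` whose generators span a cone in the fan form a simplicial complex (as they
do for simplicial fans), the underlying simplicial complex consists of exactly these sets. -/
theorem ConeFan.underlyingComplex_eq_spanningSets {n r : ℕ} (F : ConeFan n)
    (ν : Fin r → Fin n → ℤ) (h : IsLowerSet (F.spanningSets ν)) :
    F.underlyingComplex ν = F.spanningSets ν := by
  ext I
  exact ⟨fun ⟨_, hIJ, hJ⟩ => h hIJ hJ, fun hI => ⟨I, Finset.Subset.refl I, hI⟩⟩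

/-! ### Polyhedral products and the Davis–Januszkiewicz space -/

/-- The polyhedral product `Z_K(X, A)`: the union over `σ ∈ K` of the sets of all tuples `x` with
`x_k ∈ A_k` for `k ∉ σ`, as a subspace of the product `∏ X_k`. -/
def polyhedralProduct {ι : Type*} (K : Set (Finset ι)) (X : ι → Type*) (A : ∀ i, Set (X i)) :
    Set (∀ i, X i) :=
  ⋃ σ ∈ K, {x | ∀ k, k ∉ σ → x k ∈ A k}

/-- The vector `(v_0, …, v_N, 0, 0, …)` of `ℂ^∞`. -/
def extendByZero {N : ℕ} (v : Fin (N + 1) → ℂ) : ℕ →₀ ℂ :=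
  Finsupp.embDomain Fin.valEmbedding (Finsupp.equivFunOnFinite.symm v)

theorem extendByZero_ne_zero {N : ℕ} {v : Fin (N + 1) → ℂ} (hv : v ≠ 0) :
    extendByZero v ≠ 0 := by
  intro h
  apply hv
  have h1 := Finsupp.embDomain_eq_zero.mp h
  ext i
  exact DFunLike.congr_fun h1 i

/-- The infinite complex projective space, as the set of lines in `ℂ^∞ = ⨁_ℕ ℂ`. -/
def CPInfty : Type := Projectivization ℂ (ℕ →₀ ℂ)

/-- The map `ℂ^{N+1} \ {0} → ℂP^N ⊆ ℂP^∞`. -/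
def CPInfty.ofFin (N : ℕ) (v : {v : Fin (N + 1) → ℂ // v ≠ 0}) : CPInfty :=
  Projectivization.mk ℂ (extendByZero v.1) (extendByZero_ne_zero v.2)

/-- `ℂP^∞` is the union of the `ℂP^N` with the weak (colimit) topology, where `ℂP^N` has the quotient
topology from `ℂ^{N+1} \ {0}`: a set is open iff for each `N` its preimage in `ℂ^{N+1} \ {0}` is. -/
instance : TopologicalSpace CPInfty :=
  ⨆ N : ℕ, TopologicalSpace.coinduced (CPInfty.ofFin N) inferInstance

/-- The base point `[1 : 0 : 0 : ⋯]` of `ℂP^∞`. -/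
def CPInfty.base : CPInfty :=
  Projectivization.mk ℂ (Finsupp.single 0 1) (by simp)

/-- The Davis–Januszkiewicz space `DJ(K) = Z_K(ℂP^∞, *)`. -/
abbrev DavisJanuszkiewicz {ι : Type*} (K : Set (Finset ι)) : Type _ :=
  polyhedralProduct K (fun _ : ι => CPInfty) (fun _ => {CPInfty.base})

/-! ### Symmetric products and spaces of tuples of configurations -/

/-- The `d`-th symmetric product `SP^d(X) = X^d / S_d`; its points are the multisets of `d` points
of `X`. -/
def SymProd (X : Type*) (d : ℕ) : Type _ := Sym X d

/-- The multiset of points of an element of `SP^d(X)`. -/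
def SymProd.points {X : Type*} {d : ℕ} (ξ : SymProd X d) : Multiset X := Sym.toMultiset ξ

/-- The quotient map `X^d → SP^d(X)`, whose fibres are the `S_d`-orbits. -/
def SymProd.mk {X : Type*} {d : ℕ} (x : Fin d → X) : SymProd X d :=
  (⟨Multiset.map x Finset.univ.val, by simp⟩ : Sym X d)

/-- `SP^d(X)` carries the quotient topology from `X^d`. -/
instance {X : Type*} [TopologicalSpace X] (d : ℕ) : TopologicalSpace (SymProd X d) :=
  TopologicalSpace.coinduced SymProd.mk inferInstance

/-- `E_D(X)` for a simplicial complex `K` on the index set `ι`: the tuples `(ξ_i)` in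
`∏ SP^{d_i}(X)` such that `⋂_{i ∈ σ} ξ_i = ∅` for each `σ` that is not in `K`. -/
abbrev ConfTuple {ι : Type*} (K : Set (Finset ι)) (X : Type*) (D : ι → ℕ) : Type _ :=
  {ξ : ∀ i, SymProd X (D i) // ∀ σ : Finset ι, σ ∉ K → ¬ ∃ x : X, ∀ i ∈ σ, x ∈ (ξ i).points}

open Classical in
/-- `ξ ∩ (X \ A)` for each of the configurations of a tuple: the points outside `A`, with their
multiplicities. -/
def ConfTuple.outside {ι : Type*} {K : Set (Finset ι)} {X : Type*} (A : Set X) {D : ι → ℕ}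
    (ξ : ConfTuple K X D) : ι → Multiset X :=
  fun i => (ξ.1 i).points.filter (fun x => x ∉ A)

/-- `E_D(X, A) = E_D(X) / ∼`, with the quotient topology, where `ξ ∼ η` if
`ξ_i ∩ (X \ A) = η_i ∩ (X \ A)` for each `i`. -/
abbrev RelConfTuple {ι : Type*} (K : Set (Finset ι)) (X : Type*) (A : Set X) (D : ι → ℕ) :
    Type _ :=
  Quotient (Setoid.ker (ConfTuple.outside (K := K) A (D := D)))

/-- The tuple `(ξ_i ∩ (X \ A))_i` of an element of `E_D(X, A)`; it determines the element. -/
def RelConfTuple.outside {ι : Type*} {K : Set (Finset ι)} {X : Type*} {A : Set X} {D : ι → ℕ}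
    (ξ : RelConfTuple K X A D) : ι → Multiset X :=
  Quotient.lift (ConfTuple.outside A) (fun _ _ h => h) ξ

/-- `E(X, A) = ⋃_{k ≥ 0} E_{D(k)}(X, A)`, `D(k) = (d_i + k)_i`, with the colimit topology. The
inclusions of these spaces into each other, which add points of `A`, leave the points outside `A`
unchanged, so elements of the `E_{D(k)}(X, A)` for different `k` are identified when they have the
same points outside `A`. -/
abbrev StableRelConfTuple {ι : Type*} (K : Set (Finset ι)) (X : Type*) (A : Set X) (D : ι → ℕ) :
    Type _ :=
  Quotient (Setoid.ker
    (fun p : (Σ k : ℕ, RelConfTuple K X A (fun i => D i + k)) => p.2.outside))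

/-- The closed unit disc in `ℂ`, the closure of `U = {w : |w| < 1}`. -/
abbrev ClosedDisc : Type := Metric.closedBall (0 : ℂ) 1

/-- The boundary circle of the closed unit disc. -/
def discBoundary : Set ClosedDisc := {z | ‖(z : ℂ)‖ = 1}

end

/-!
Only two properties of the complex `K` of the fan matter: it is closed under passing to subsets and
contains all singletons. Write `X` for the closed disc and `A` for its boundary.

A configuration `ξ` of points of the disc is sent to the product of the linear polynomials
`z - (1 - ‖z‖) T`, `z ∈ ξ`, whose coefficients are homogeneous coordinates of a point of `ℂP^∞`. As
points on the boundary circle contribute nonzero constants, and by the fundamental theorem of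
algebra, this identifies the infinite symmetric product of `(X, A)` with `ℂP^∞`
(`CPInfty.ofConfig_eq_iff`, `CPInfty.exists_ofConfig`), the base point corresponding to the empty
configuration. It follows that there is a continuous injection `toCPInfty` of `E(X, A)` into a power
of `ℂP^∞`. Its image contains the Davis–Januszkiewicz space, which corresponds to the tuples whose
nonempty members form a simplex of `K`.

The space `E(X, A)` is deformed by radial expansion. If no set of configurations outside `K` has the
origin as a common point, then there is a radius (`simplexRadius`), depending continuously on the
tuple, such that the configurations with points of smaller norm form a simplex of `K`. Expanding
until this radius reaches the boundary circle moves the tuple into the Davis–Januszkiewicz space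
(`exists_simplex_expandConfig_one`), whose elements have radius `1` and do not move.

The topology of `E(X, A)` is strictly finer than the one induced by `toCPInfty` in general, because
the intersection conditions also apply to points of `A`. So maps into `E(X, A)` are shown to be
continuous by lifting them locally to ordered tuples (`exists_continuous_of_ordered_lifts`); points
reaching `A` are replaced by generic points of `A` to avoid collisions. This applies to the
expansion (`exists_continuous_expand`), and to the inverse of `toCPInfty` on the
Davis–Januszkiewicz space (`exists_continuous_ofDavisJanuszkiewicz`). For the latter one needs that
finite powers of `ℂP^∞` carry the weak topology with respect to the compact images of powers of the
disc (`CPInfty.isOpen_pi`), which is a general fact on weak topologies of sequences of compact sets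
(`isOpen_pi_of_isOpen_preimage`).
-/

open Set Filter Topology

/-! ### Finite powers of unions of sequences of compact spaces -/

/-- A tube lemma for finite powers of a compact Hausdorff space, in terms of compact
neighbourhoods. -/
theorem exists_compact_nhds_pi_subset {ι Y : Type*} [Finite ι] [TopologicalSpace Y]
    [CompactSpace Y] [T2Space Y] {O : Set (ι → Y)} (hO : IsOpen O) (A : ι → Set Y)
    (hA : ∀ i, IsCompact (A i)) (hAO : univ.pi A ⊆ O) :
    ∃ B : ι → Set Y, (∀ i, IsCompact (B i)) ∧ (∀ i, ∃ V, IsOpen V ∧ A i ⊆ V ∧ V ⊆ B i) ∧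
      univ.pi B ⊆ O := by
  classical
  cases nonempty_fintype ι
  suffices H : ∀ s : Finset ι, ∃ B : ι → Set Y, (∀ i, IsCompact (B i)) ∧
      (∀ i ∈ s, ∃ V, IsOpen V ∧ A i ⊆ V ∧ V ⊆ B i) ∧ (∀ i, i ∉ s → B i = A i) ∧
      univ.pi B ⊆ O by
    obtain ⟨B, h1, h2, -, h4⟩ := H Finset.univ
    exact ⟨B, h1, fun i => h2 i (Finset.mem_univ i), h4⟩
  intro s
  induction s using Finset.induction_on with
  | empty => exact ⟨A, hA, by simp, fun _ _ => rfl, hAO⟩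
  | insert a s ha ih =>
    obtain ⟨B, hB, hBV, hBA, hBO⟩ := ih
    have hT : IsCompact (univ.pi (Function.update B a univ)) := by
      refine isCompact_univ_pi fun i => ?_
      by_cases h : i = a
      · subst h; simpa using isCompact_univ
      · simpa [h] using hB i
    have hcont : Continuous fun p : Y × (ι → Y) => Function.update p.2 a p.1 :=
      continuous_snd.update a continuous_fst
    obtain ⟨U, W, hU, hW, hAU, hTW, hUW⟩ := generalized_tube_lemma (hB a) hT
      (hO.preimage hcont) (by
        rintro ⟨y, x⟩ ⟨hy, hx⟩
        refine hBO fun i _ => ?_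
        by_cases h : i = a
        · subst h; simpa using hy
        · simpa [h] using hx i (mem_univ i))
    obtain ⟨L, hL, hAL, hLU⟩ := exists_compact_between (hB a) hU hAU
    refine ⟨Function.update B a L, fun i => ?_, fun i hi => ?_, fun i hi => ?_, fun x hx => ?_⟩
    · by_cases h : i = a
      · subst h; simpa using hL
      · simpa [h] using hB i
    · by_cases h : i = a
      · subst h
        refine ⟨interior L, isOpen_interior, ?_, by simpa using interior_subset⟩
        rw [← hBA i ha]; exact hAL
      · simpa [h] using hBV i ((Finset.mem_insert.mp hi).resolve_left h)
    · rw [Finset.mem_insert, not_or] at hi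
      simpa [hi.1] using hBA i hi.2
    · have hxa : x a ∈ L := by simpa using hx a (mem_univ a)
      have : (x a, x) ∈ U ×ˢ W := by
        refine ⟨hLU hxa, hTW fun i _ => ?_⟩
        by_cases h : i = a
        · subst h; simp
        · simpa [h] using hx i (mem_univ i)
      simpa using hUW this

/-- Let the Hausdorff space `X` carry the weak topology with respect to an increasing sequence of
compact images `π N '' K N`. Then finite powers of `X` carry the weak topology with respect to the
powers of these images. -/
theorem isOpen_pi_of_isOpen_preimage {ι X : Type*} [Finite ι] [TopologicalSpace X] [T2Space X]
    {K : ℕ → Type*} [∀ N, TopologicalSpace (K N)] [∀ N, CompactSpace (K N)]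
    (π : ∀ N, K N → X) (hπ : ∀ N, Continuous (π N))
    (hmono : Monotone fun N => range (π N)) (hcov : ∀ x, ∃ N, x ∈ range (π N))
    (hweak : ∀ V : Set X, (∀ N, IsOpen (π N ⁻¹' V)) → IsOpen V)
    (O : Set (ι → X)) (hO : ∀ N, IsOpen ((fun (y : ι → K N) i => π N (y i)) ⁻¹' O)) :
    IsOpen O := by
  classical
  cases nonempty_fintype ι
  have step : ∀ N, ∀ A : {A : ι → Set X // (∀ i, IsCompact (A i)) ∧
      (∀ i, A i ⊆ range (π N)) ∧ univ.pi A ⊆ O},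
      ∃ B : {B : ι → Set X // (∀ i, IsCompact (B i)) ∧
        (∀ i, B i ⊆ range (π (N + 1))) ∧ univ.pi B ⊆ O},
        ∀ i, ∃ U, IsOpen U ∧ A.1 i ⊆ U ∧ U ∩ range (π (N + 1)) ⊆ B.1 i := by
    rintro N ⟨A, hA, hAN, hAO⟩
    let Y := range (π (N + 1))
    have : CompactSpace Y := isCompact_iff_compactSpace.mp (isCompact_range (hπ (N + 1)))
    -- Maps from compact to Hausdorff spaces are closed, so `p` is a quotient map.
    let p : (ι → K (N + 1)) → (ι → Y) := fun y i => ⟨π (N + 1) (y i), mem_range_self _⟩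
    have hp : Continuous p := by
      refine continuous_pi fun i => Continuous.subtype_mk ((hπ _).comp (continuous_apply i)) _
    have hps : Function.Surjective p := by
      intro y
      choose z hz using fun i => (y i).2
      exact ⟨z, funext fun i => Subtype.ext (hz i)⟩
    have hq : IsQuotientMap p := hp.isClosedMap.isQuotientMap hp hps
    have hO' : IsOpen {y : ι → Y | (fun i => (y i : X)) ∈ O} := by
      rw [← hq.isOpen_preimage]
      exact hO (N + 1)
    obtain ⟨B, hB, hBV, hBO⟩ := exists_compact_nhds_pi_subset hO'
      (fun i => ((↑) : Y → X) ⁻¹' A i)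
      (fun i => ((hA i).isClosed.preimage continuous_subtype_val).isCompact)
      (fun y hy => hAO fun i _ => hy i (mem_univ i))
    refine ⟨⟨fun i => (↑) '' B i, fun i => (hB i).image continuous_subtype_val, ?_, ?_⟩, ?_⟩
    · rintro i _ ⟨y, -, rfl⟩
      exact y.2
    · intro x hx
      choose y hy hyx using fun i => hx i (mem_univ i)
      have : (fun i => (y i : X)) ∈ O := hBO (show y ∈ univ.pi B from fun i _ => hy i)
      simpa [hyx] using this
    · intro i
      obtain ⟨V, hV, hAV, hVB⟩ := hBV i
      obtain ⟨U, hU, rfl⟩ := isOpen_induced_iff.mp hV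
      refine ⟨U, hU, fun x hx => ?_, ?_⟩
      · exact hAV (show (⟨x, hmono (Nat.le_succ N) (hAN i hx)⟩ : Y) ∈ _ from hx)
      · rintro x ⟨hxU, hxY⟩
        exact ⟨⟨x, hxY⟩, hVB hxU, rfl⟩
  choose f hf using step
  -- A point of `O` is enlarged step by step to products of compact sets inside `O`, each being a
  -- neighbourhood of the previous one in the next image; their union is open in the weak topology.
  rw [isOpen_iff_forall_mem_open]
  intro x hx
  obtain ⟨N₀, hN₀⟩ : ∃ N, ∀ i, x i ∈ range (π N) := by
    choose M hM using fun i => hcov (x i)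
    exact ⟨Finset.univ.sup M, fun i => hmono (Finset.le_sup (Finset.mem_univ i)) (hM i)⟩
  let A : ∀ n, {A : ι → Set X // (∀ i, IsCompact (A i)) ∧
      (∀ i, A i ⊆ range (π (N₀ + n))) ∧ univ.pi A ⊆ O} := fun n =>
    Nat.rec ⟨fun i => {x i}, fun i => isCompact_singleton,
      fun i => singleton_subset_iff.mpr (hN₀ i), by simpa [univ_pi_singleton] using hx⟩
      (fun n A => f (N₀ + n) A) n
  have hAs : ∀ n i, ∃ U, IsOpen U ∧ (A n).1 i ⊆ U ∧
      U ∩ range (π (N₀ + n + 1)) ⊆ (A (n + 1)).1 i := fun n i => hf (N₀ + n) (A n) i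
  have hAm : ∀ i, Monotone fun n => (A n).1 i := by
    intro i
    refine monotone_nat_of_le_succ fun n y hy => ?_
    obtain ⟨U, -, hAU, hU⟩ := hAs n i
    exact hU ⟨hAU hy, hmono (Nat.le_succ _) ((A n).2.2.1 i hy)⟩
  refine ⟨univ.pi fun i => ⋃ n, (A n).1 i, fun y hy => ?_, isOpen_set_pi finite_univ
    fun i _ => hweak _ fun M => ?_, fun i _ => mem_iUnion.mpr ⟨0, rfl⟩⟩
  · choose n hn using fun i => mem_iUnion.mp (hy i (mem_univ i))
    exact (A (Finset.univ.sup n)).2.2.2 fun i _ =>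
      hAm i (Finset.le_sup (Finset.mem_univ i)) (hn i)
  · rw [isOpen_iff_forall_mem_open]
    intro w hw
    obtain ⟨n, hn⟩ := mem_iUnion.mp hw
    obtain ⟨U, hU, hAU, hUA⟩ := hAs (max n M) i
    refine ⟨π M ⁻¹' U, fun v hv => ?_, hU.preimage (hπ M),
      hAU (hAm i (le_max_left n M) hn)⟩
    refine mem_iUnion.mpr ⟨max n M + 1, hUA ⟨hv, hmono ?_ (mem_range_self v)⟩⟩
    have := le_max_right n M
    omega

/-! ### The infinite projective space is Hausdorff -/

/-- The entries `v_j \bar v_l / ‖v‖²` of the orthogonal projection onto the line spanned by `v`, as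
functions on `ℂP^∞`. -/
noncomputable def CPInfty.projEntry (j l : ℕ) : CPInfty → ℂ :=
  Projectivization.lift
    (fun v : {v : ℕ →₀ ℂ // v ≠ 0} =>
      v.1 j * (starRingEnd ℂ) (v.1 l) / (v.1.sum fun _ c => (c * (starRingEnd ℂ) c)))
    (by
      rintro ⟨v, hv⟩ ⟨w, hw⟩ t (h : v = t • w)
      have ht : t ≠ 0 := by rintro rfl; simp at h; exact hv h
      have ht' : (starRingEnd ℂ) t ≠ 0 := by simpa using ht
      subst h
      have h1 : ((t • w).sum fun _ c => (c * (starRingEnd ℂ) c)) =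
          (t * (starRingEnd ℂ) t) * (w.sum fun _ c => (c * (starRingEnd ℂ) c)) := by
        rw [Finsupp.sum_smul_index (by simp), Finsupp.mul_sum]
        refine Finset.sum_congr rfl fun i _ => ?_
        simp only [map_mul]; ring
      simp only [h1, Finsupp.smul_apply, smul_eq_mul, map_mul]
      rw [show t * w j * ((starRingEnd ℂ) t * (starRingEnd ℂ) (w l)) =
        (t * (starRingEnd ℂ) t) * (w j * (starRingEnd ℂ) (w l)) by ring,
        mul_div_mul_left _ _ (mul_ne_zero ht ht')])

theorem extendByZero_apply {N : ℕ} (v : Fin (N + 1) → ℂ) (j : ℕ) :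
    extendByZero v j = if h : j < N + 1 then v ⟨j, h⟩ else 0 := by
  unfold extendByZero
  split_ifs with h
  · exact Finsupp.embDomain_apply_self Fin.valEmbedding _ ⟨j, h⟩
  · refine Finsupp.embDomain_of_notMem_range _ _ _ ?_
    rintro ⟨i, rfl⟩
    exact h i.2

theorem sum_mul_conj_ne_zero {v : ℕ →₀ ℂ} (hv : v ≠ 0) :
    (v.sum fun _ c => (c * (starRingEnd ℂ) c)) ≠ 0 := by
  obtain ⟨i, hi⟩ := Finsupp.ne_iff.mp hv
  have h : (v.sum fun _ c => (c * (starRingEnd ℂ) c)) =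
      ((v.sum fun _ c => ‖c‖ ^ 2 : ℝ) : ℂ) := by
    simp [Finsupp.sum, Complex.mul_conj, Complex.normSq_eq_norm_sq]
  rw [h, Complex.ofReal_ne_zero]
  refine (Finset.sum_pos' (fun _ _ => by positivity)
    ⟨i, Finsupp.mem_support_iff.mpr hi, ?_⟩).ne'
  have : v i ≠ 0 := hi
  positivity

theorem CPInfty.continuous_iff {Y : Type*} [TopologicalSpace Y] {f : CPInfty → Y} :
    Continuous f ↔ ∀ N, Continuous (f ∘ CPInfty.ofFin N) := by
  simp only [continuous_iSup_dom, continuous_coinduced_dom]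

theorem CPInfty.continuous_ofFin (N : ℕ) : Continuous (CPInfty.ofFin N) :=
  CPInfty.continuous_iff.mp continuous_id N

theorem CPInfty.isOpen_iff {V : Set CPInfty} :
    IsOpen V ↔ ∀ N, IsOpen (CPInfty.ofFin N ⁻¹' V) := by
  simp only [isOpen_iSup_iff, isOpen_coinduced]

theorem CPInfty.continuous_projEntry (j l : ℕ) : Continuous (CPInfty.projEntry j l) := by
  refine CPInfty.continuous_iff.mpr fun N => ?_
  have happ : ∀ j, Continuous fun v : {v : Fin (N + 1) → ℂ // v ≠ 0} => extendByZero v.1 j := by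
    intro j
    simp only [extendByZero_apply]
    split_ifs with h
    · exact (continuous_apply _).comp continuous_subtype_val
    · exact continuous_const
  have hsum : ∀ v : Fin (N + 1) → ℂ, ((extendByZero v).sum fun _ c => (c * (starRingEnd ℂ) c)) =
      ∑ i, v i * (starRingEnd ℂ) (v i) := by
    intro v
    unfold extendByZero
    rw [Finsupp.sum_embDomain, Finsupp.sum_fintype _ _ (by simp)]
    rfl
  have heq : CPInfty.projEntry j l ∘ CPInfty.ofFin N = fun v : {v : Fin (N + 1) → ℂ // v ≠ 0} =>
      extendByZero v.1 j * (starRingEnd ℂ) (extendByZero v.1 l) /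
        ((extendByZero v.1).sum fun _ c => (c * (starRingEnd ℂ) c)) := rfl
  rw [heq]
  refine ((happ j).mul (Complex.continuous_conj.comp (happ l))).div ?_
    fun v => sum_mul_conj_ne_zero (extendByZero_ne_zero v.2)
  simp only [hsum]
  refine continuous_finsetSum _ fun i _ => ?_
  have h := (continuous_apply i).comp
    (continuous_subtype_val : Continuous fun v : {v : Fin (N + 1) → ℂ // v ≠ 0} => v.1)
  exact h.mul (Complex.continuous_conj.comp h)

theorem CPInfty.projEntry_injective :
    Function.Injective fun (x : CPInfty) (jl : ℕ × ℕ) => CPInfty.projEntry jl.1 jl.2 x := by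
  intro x y hxy
  induction x using Projectivization.ind with | h v hv =>
  induction y using Projectivization.ind with | h w hw =>
  have h : ∀ j l, v j * (starRingEnd ℂ) (v l) / (v.sum fun _ c => (c * (starRingEnd ℂ) c)) =
      w j * (starRingEnd ℂ) (w l) / (w.sum fun _ c => (c * (starRingEnd ℂ) c)) :=
    fun j l => congrFun hxy (j, l)
  have hSv := sum_mul_conj_ne_zero hv
  have hSw := sum_mul_conj_ne_zero hw
  set Sv := v.sum fun _ c => (c * (starRingEnd ℂ) c)
  set Sw := w.sum fun _ c => (c * (starRingEnd ℂ) c)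
  obtain ⟨l, hl⟩ := Finsupp.ne_iff.mp hw
  have hwl : w l ≠ 0 := hl
  have hvl : (starRingEnd ℂ) (v l) ≠ 0 := by
    intro h0
    have := h l l
    rw [h0, mul_zero, zero_div, eq_comm, div_eq_zero_iff] at this
    simp [hwl, hSw] at this
  refine (Projectivization.mk_eq_mk_iff' ℂ v w hv hw).mpr
    ⟨(starRingEnd ℂ) (w l) * Sv / (Sw * (starRingEnd ℂ) (v l)), Finsupp.ext fun j => ?_⟩
  have := h j l
  rw [div_eq_div_iff hSv hSw] at this
  rw [Finsupp.smul_apply, smul_eq_mul, div_mul_eq_mul_div, div_eq_iff (mul_ne_zero hSw hvl)]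
  linear_combination -this

instance : T2Space CPInfty :=
  .of_injective_continuous CPInfty.projEntry_injective
    (continuous_pi fun jl => CPInfty.continuous_projEntry jl.1 jl.2)

/-! ### Points of the infinite projective space as configurations in the open disc -/

open Polynomial in
/-- The point of `ℂP^∞` whose homogeneous coordinates are the coefficients of a polynomial. -/
noncomputable def CPInfty.ofPoly (p : ℂ[X]) (hp : p ≠ 0) : CPInfty :=
  Projectivization.mk ℂ p.toFinsupp.coeff (fun h => hp (by
    ext n
    exact DFunLike.congr_fun h n))

section
open Polynomial

theorem CPInfty.exists_ofPoly (x : CPInfty) : ∃ p hp, x = CPInfty.ofPoly p hp := by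
  induction x using Projectivization.ind with | h v hv =>
  exact ⟨⟨⟨v⟩⟩, fun h => hv (by ext n; exact congrArg (fun q : ℂ[X] => q.coeff n) h), rfl⟩

theorem CPInfty.ofPoly_eq_iff {p q : ℂ[X]} (hp : p ≠ 0) (hq : q ≠ 0) :
    CPInfty.ofPoly p hp = CPInfty.ofPoly q hq ↔ p.roots = q.roots := by
  refine (Projectivization.mk_eq_mk_iff' ℂ _ _ _ _).trans ?_
  constructor
  · rintro ⟨a, ha⟩
    have h : p = C a * q := by
      ext n
      rw [coeff_C_mul]
      exact (DFunLike.congr_fun ha n).symm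
    have ha0 : a ≠ 0 := by rintro rfl; simp [hp] at h
    rw [h, roots_C_mul _ ha0]
  · intro h
    have h1 := (IsAlgClosed.splits p).eq_prod_roots
    have h2 := (IsAlgClosed.splits q).eq_prod_roots
    rw [h] at h1
    have h3 : p = C (p.leadingCoeff / q.leadingCoeff) * q :=
      calc p = C p.leadingCoeff * (q.roots.map fun a => X - C a).prod := h1
        _ = C (p.leadingCoeff / q.leadingCoeff) *
            (C q.leadingCoeff * (q.roots.map fun a => X - C a).prod) := by
          rw [← mul_assoc, ← C_mul, div_mul_cancel₀ _ (leadingCoeff_ne_zero.mpr hq)]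
        _ = C (p.leadingCoeff / q.leadingCoeff) * q := by rw [← h2]
    refine ⟨p.leadingCoeff / q.leadingCoeff, Finsupp.ext fun n => ?_⟩
    conv_rhs => rw [h3]
    exact (coeff_C_mul _).symm

theorem CPInfty.base_eq_ofPoly : CPInfty.base = CPInfty.ofPoly 1 one_ne_zero := by
  unfold CPInfty.base CPInfty.ofPoly
  congr 1

/-- The linear polynomial `z - (1 - ‖z‖) X`: its root `z / (1 - ‖z‖)` moves to infinity as `z`
approaches the boundary of the disc, where the polynomial becomes a nonzero constant. -/
noncomputable def discFactor (z : ClosedDisc) : ℂ[X] :=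
  C (z : ℂ) - C ((1 - ‖(z : ℂ)‖ : ℝ) : ℂ) * X

theorem ClosedDisc.norm_le_one (z : ClosedDisc) : ‖(z : ℂ)‖ ≤ 1 :=
  mem_closedBall_zero_iff.mp z.2

theorem one_sub_norm_eq_zero_iff {z : ClosedDisc} : 1 - ‖(z : ℂ)‖ = 0 ↔ z ∈ discBoundary := by
  rw [sub_eq_zero, eq_comm]; rfl

theorem roots_discFactor_of_mem {z : ClosedDisc} (hz : z ∈ discBoundary) :
    (discFactor z).roots = 0 := by
  simp [discFactor, one_sub_norm_eq_zero_iff.mpr hz]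

theorem roots_discFactor_of_notMem {z : ClosedDisc} (hz : z ∉ discBoundary) :
    (discFactor z).roots = {(z : ℂ) / ((1 - ‖(z : ℂ)‖ : ℝ) : ℂ)} := by
  have h0 : ((1 - ‖(z : ℂ)‖ : ℝ) : ℂ) ≠ 0 :=
    Complex.ofReal_ne_zero.mpr (mt one_sub_norm_eq_zero_iff.mp hz)
  have h : discFactor z = C (-((1 - ‖(z : ℂ)‖ : ℝ) : ℂ)) *
      (X - C ((z : ℂ) / ((1 - ‖(z : ℂ)‖ : ℝ) : ℂ))) := by
    rw [mul_sub, ← C_mul, neg_mul, mul_div_cancel₀ _ h0, discFactor, C_neg, C_neg]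
    ring
  rw [h, roots_C_mul _ (neg_ne_zero.mpr h0), roots_X_sub_C]

theorem discFactor_ne_zero (z : ClosedDisc) : discFactor z ≠ 0 := by
  intro h
  have h0 : (z : ℂ) = 0 := by simpa [discFactor] using congrArg (fun p : ℂ[X] => p.coeff 0) h
  have h1 := congrArg (fun p : ℂ[X] => p.coeff 1) h
  simp [discFactor, h0] at h1

/-- The product of the polynomials `z - (1 - ‖z‖) X` over a configuration. -/
noncomputable def configPoly (ξ : Multiset ClosedDisc) : ℂ[X] := (ξ.map discFactor).prod

theorem configPoly_ne_zero (ξ : Multiset ClosedDisc) : configPoly ξ ≠ 0 := by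
  refine Multiset.prod_ne_zero fun h => ?_
  obtain ⟨z, -, hz⟩ := Multiset.mem_map.mp h
  exact discFactor_ne_zero z hz

open Classical in
/-- The points of a configuration that lie in the open disc. -/
noncomputable def interiorPart (ξ : Multiset ClosedDisc) : Multiset ClosedDisc :=
  ξ.filter (fun z => z ∉ discBoundary)

@[simp] theorem mem_interiorPart {ξ : Multiset ClosedDisc} {z : ClosedDisc} :
    z ∈ interiorPart ξ ↔ z ∈ ξ ∧ z ∉ discBoundary := by
  classical
  simp [interiorPart]

@[simp] theorem interiorPart_zero : interiorPart 0 = 0 := by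
  classical
  simp [interiorPart]

theorem interiorPart_cons_of_mem {z : ClosedDisc} (hz : z ∈ discBoundary)
    (ξ : Multiset ClosedDisc) : interiorPart (z ::ₘ ξ) = interiorPart ξ := by
  classical
  simp [interiorPart, hz]

theorem interiorPart_cons_of_notMem {z : ClosedDisc} (hz : z ∉ discBoundary)
    (ξ : Multiset ClosedDisc) : interiorPart (z ::ₘ ξ) = z ::ₘ interiorPart ξ := by
  classical
  simp [interiorPart, hz]

theorem interiorPart_eq_self {ξ : Multiset ClosedDisc} (h : ∀ z ∈ ξ, z ∉ discBoundary) :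
    interiorPart ξ = ξ := by
  classical
  exact Multiset.filter_eq_self.mpr h

theorem interiorPart_eq_zero {ξ : Multiset ClosedDisc} (h : ∀ z ∈ ξ, z ∈ discBoundary) :
    interiorPart ξ = 0 :=
  Multiset.eq_zero_of_forall_notMem fun z hz =>
    (mem_interiorPart.mp hz).2 (h z (mem_interiorPart.mp hz).1)

theorem interiorPart_add (ξ η : Multiset ClosedDisc) :
    interiorPart (ξ + η) = interiorPart ξ + interiorPart η := by
  classical
  exact Multiset.filter_add _ _ _

@[simp] theorem interiorPart_interiorPart (ξ : Multiset ClosedDisc) :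
    interiorPart (interiorPart ξ) = interiorPart ξ :=
  interiorPart_eq_self fun _ hz => (mem_interiorPart.mp hz).2

theorem roots_configPoly (ξ : Multiset ClosedDisc) : (configPoly ξ).roots =
    (interiorPart ξ).map fun z : ClosedDisc => (z : ℂ) / ((1 - ‖(z : ℂ)‖ : ℝ) : ℂ) := by
  induction ξ using Multiset.induction_on with
  | empty => simp [configPoly]
  | cons z ξ ih =>
    have h : configPoly (z ::ₘ ξ) = discFactor z * configPoly ξ := by simp [configPoly]
    rw [h, roots_mul (mul_ne_zero (discFactor_ne_zero z) (configPoly_ne_zero ξ)), ih]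
    by_cases hz : z ∈ discBoundary
    · rw [interiorPart_cons_of_mem hz, roots_discFactor_of_mem hz, zero_add]
    · rw [interiorPart_cons_of_notMem hz, roots_discFactor_of_notMem hz, Multiset.map_cons,
        Multiset.singleton_add]

/-- The homeomorphism `w ↦ w / (1 + ‖w‖)` from `ℂ` to the open disc. -/
noncomputable def discPoint (w : ℂ) : ClosedDisc :=
  ⟨w / ((1 + ‖w‖ : ℝ) : ℂ), by
    have h : 0 < 1 + ‖w‖ := by positivity
    rw [mem_closedBall_zero_iff, norm_div, Complex.norm_real, Real.norm_of_nonneg h.le,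
      div_le_one h]
    linarith⟩

theorem norm_discPoint (w : ℂ) : ‖(discPoint w : ℂ)‖ = ‖w‖ / (1 + ‖w‖) := by
  have h : 0 < 1 + ‖w‖ := by positivity
  simp only [discPoint]
  rw [norm_div, Complex.norm_real, Real.norm_of_nonneg h.le]

theorem discPoint_notMem (w : ℂ) : discPoint w ∉ discBoundary := by
  intro h
  have h0 : 0 < 1 + ‖w‖ := by positivity
  have h1 : ‖(discPoint w : ℂ)‖ = 1 := h
  rw [norm_discPoint, div_eq_one_iff_eq h0.ne'] at h1
  linarith

theorem discPoint_div {z : ClosedDisc} (hz : z ∉ discBoundary) :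
    discPoint ((z : ℂ) / ((1 - ‖(z : ℂ)‖ : ℝ) : ℂ)) = z := by
  have h0 : 0 < 1 - ‖(z : ℂ)‖ :=
    lt_of_le_of_ne (sub_nonneg.mpr z.norm_le_one) (Ne.symm (mt one_sub_norm_eq_zero_iff.mp hz))
  apply Subtype.ext
  simp only [discPoint]
  rw [norm_div, Complex.norm_real, Real.norm_of_nonneg h0.le]
  have h1 : 1 + ‖(z : ℂ)‖ / (1 - ‖(z : ℂ)‖) = (1 - ‖(z : ℂ)‖)⁻¹ := by field_simp; ring
  rw [h1, Complex.ofReal_inv, div_inv_eq_mul, div_mul_cancel₀]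
  exact Complex.ofReal_ne_zero.mpr h0.ne'

theorem discPoint_div_one_sub_norm (w : ℂ) :
    (discPoint w : ℂ) / ((1 - ‖(discPoint w : ℂ)‖ : ℝ) : ℂ) = w := by
  have h0 : 0 < 1 + ‖w‖ := by positivity
  have h1 : 1 - ‖w‖ / (1 + ‖w‖) = (1 + ‖w‖)⁻¹ := by field_simp; ring
  rw [norm_discPoint, h1, Complex.ofReal_inv, div_inv_eq_mul]
  simp only [discPoint]
  rw [div_mul_cancel₀]
  exact Complex.ofReal_ne_zero.mpr h0.ne'

/-- The point of `ℂP^∞` given by a configuration in the closed disc. -/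
noncomputable def CPInfty.ofConfig (ξ : Multiset ClosedDisc) : CPInfty :=
  CPInfty.ofPoly (configPoly ξ) (configPoly_ne_zero ξ)

/-- `ℂP^∞` is the infinite symmetric product of the disc relative to its boundary: a configuration
is determined, up to points of the boundary circle, by the associated point of `ℂP^∞`. -/
theorem CPInfty.ofConfig_eq_iff {ξ η : Multiset ClosedDisc} :
    CPInfty.ofConfig ξ = CPInfty.ofConfig η ↔ interiorPart ξ = interiorPart η := by
  have h : ∀ ζ : Multiset ClosedDisc,
      (configPoly ζ).roots.map discPoint = interiorPart ζ := by
    intro ζ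
    rw [roots_configPoly, Multiset.map_map]
    conv_rhs => rw [← Multiset.map_id (interiorPart ζ)]
    exact Multiset.map_congr rfl fun z hz => discPoint_div (mem_interiorPart.mp hz).2
  rw [CPInfty.ofConfig, CPInfty.ofConfig, CPInfty.ofPoly_eq_iff]
  refine ⟨fun e => ?_, fun e => ?_⟩
  · rw [← h, ← h, e]
  · rw [roots_configPoly, roots_configPoly, e]

theorem interiorPart_map_discPoint (s : Multiset ℂ) :
    interiorPart (s.map discPoint) = s.map discPoint := by
  refine interiorPart_eq_self fun z hz => ?_
  obtain ⟨w, -, rfl⟩ := Multiset.mem_map.mp hz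
  exact discPoint_notMem w

theorem CPInfty.ofPoly_eq_ofConfig (p : ℂ[X]) (hp : p ≠ 0) :
    CPInfty.ofPoly p hp = CPInfty.ofConfig (p.roots.map discPoint) := by
  rw [CPInfty.ofConfig, CPInfty.ofPoly_eq_iff, roots_configPoly, interiorPart_map_discPoint,
    Multiset.map_map]
  conv_lhs => rw [← Multiset.map_id p.roots]
  exact Multiset.map_congr rfl fun w _ => (discPoint_div_one_sub_norm w).symm

theorem CPInfty.exists_ofConfig (x : CPInfty) :
    ∃ ξ, (∀ z ∈ ξ, z ∉ discBoundary) ∧ CPInfty.ofConfig ξ = x := by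
  obtain ⟨p, hp, rfl⟩ := x.exists_ofPoly
  refine ⟨_, fun z hz => ?_, (CPInfty.ofPoly_eq_ofConfig p hp).symm⟩
  obtain ⟨w, -, rfl⟩ := Multiset.mem_map.mp hz
  exact discPoint_notMem w

theorem CPInfty.ofConfig_eq_base_iff {ξ : Multiset ClosedDisc} :
    CPInfty.ofConfig ξ = CPInfty.base ↔ interiorPart ξ = 0 := by
  have h : CPInfty.base = CPInfty.ofConfig 0 := by
    rw [CPInfty.base_eq_ofPoly, CPInfty.ofPoly_eq_ofConfig]
    simp
  rw [h, CPInfty.ofConfig_eq_iff, interiorPart_zero]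

/-! ### The infinite projective space as a union of quotients of powers of the disc -/

/-- The multiset of values of a finite tuple. -/
def tupleConfig {N : ℕ} (x : Fin N → ClosedDisc) : Multiset ClosedDisc :=
  Multiset.map x Finset.univ.val

@[simp] theorem mem_tupleConfig {N : ℕ} {x : Fin N → ClosedDisc} {z : ClosedDisc} :
    z ∈ tupleConfig x ↔ ∃ j, x j = z := by
  simp [tupleConfig]

theorem exists_tupleConfig_eq {X : Type*} {N : ℕ} (s : Multiset X) (hs : s.card = N) :
    ∃ x : Fin N → X, Multiset.map x Finset.univ.val = s := by
  induction s using Quotient.inductionOn with | h l =>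
  obtain rfl : l.length = N := hs
  exact ⟨l.get, by rw [Fin.univ_val_map, List.ofFn_get]; rfl⟩

theorem continuous_coeff_discFactor (n : ℕ) : Continuous fun z => (discFactor z).coeff n := by
  simp only [discFactor, coeff_sub, coeff_C_mul]
  refine Continuous.sub ?_ (Continuous.mul ?_ continuous_const)
  · simp only [coeff_C]
    split_ifs
    · exact continuous_subtype_val
    · exact continuous_const
  · exact Complex.continuous_ofReal.comp
      (continuous_const.sub (continuous_norm.comp continuous_subtype_val))

theorem continuous_coeff_configPoly {N : ℕ} (n : ℕ) :
    Continuous fun x : Fin N → ClosedDisc => (configPoly (tupleConfig x)).coeff n := by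
  have h : ∀ (s : Finset (Fin N)) (n : ℕ),
      Continuous fun x : Fin N → ClosedDisc => (∏ j ∈ s, discFactor (x j)).coeff n := by
    intro s
    induction s using Finset.induction_on with
    | empty => intro n; simpa using continuous_const
    | insert a s ha ih =>
      intro n
      simp only [Finset.prod_insert ha, coeff_mul]
      exact continuous_finsetSum _ fun p _ =>
        ((continuous_coeff_discFactor p.1).comp (continuous_apply a)).mul (ih p.2)
  have h2 := h Finset.univ n
  simp only [configPoly, tupleConfig, Multiset.map_map]
  exact h2

theorem natDegree_configPoly_le (ξ : Multiset ClosedDisc) :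
    (configPoly ξ).natDegree ≤ ξ.card := by
  refine (natDegree_multiset_prod_le _).trans ?_
  rw [Multiset.map_map]
  refine (Multiset.sum_le_card_nsmul _ 1 fun d hd => ?_).trans (by simp)
  obtain ⟨z, -, rfl⟩ := Multiset.mem_map.mp hd
  refine (natDegree_sub_le _ _).trans ?_
  rw [natDegree_C]
  exact max_le zero_le_one ((natDegree_C_mul_le _ _).trans natDegree_X_le)

theorem card_tupleConfig {N : ℕ} (x : Fin N → ClosedDisc) : (tupleConfig x).card = N := by
  simp [tupleConfig]

theorem CPInfty.ofPoly_eq_ofFin {N : ℕ} {p : ℂ[X]} (hp : p ≠ 0) (hN : p.natDegree ≤ N)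
    (h : (fun i : Fin (N + 1) => p.coeff i) ≠ 0) :
    CPInfty.ofPoly p hp = CPInfty.ofFin N ⟨fun i => p.coeff i, h⟩ := by
  unfold CPInfty.ofPoly CPInfty.ofFin
  congr 1
  ext n
  rw [extendByZero_apply]
  split_ifs with hn
  · rfl
  · exact coeff_eq_zero_of_natDegree_lt (by omega)

theorem coeff_fin_ne_zero {N : ℕ} {p : ℂ[X]} (hp : p ≠ 0) (hN : p.natDegree ≤ N) :
    (fun i : Fin (N + 1) => p.coeff i) ≠ 0 := fun h =>
  hp (leadingCoeff_eq_zero.mp (congrFun h ⟨p.natDegree, Nat.lt_succ_of_le hN⟩))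

theorem CPInfty.continuous_ofConfig_tuple (N : ℕ) :
    Continuous fun x : Fin N → ClosedDisc => CPInfty.ofConfig (tupleConfig x) := by
  have hd : ∀ x : Fin N → ClosedDisc, (configPoly (tupleConfig x)).natDegree ≤ N := fun x =>
    (natDegree_configPoly_le _).trans (card_tupleConfig x).le
  have h : (fun x : Fin N → ClosedDisc => CPInfty.ofConfig (tupleConfig x)) =
      fun x => CPInfty.ofFin N ⟨fun i => (configPoly (tupleConfig x)).coeff i,
        coeff_fin_ne_zero (configPoly_ne_zero _) (hd x)⟩ :=
    funext fun x => CPInfty.ofPoly_eq_ofFin _ (hd x) _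
  rw [h]
  exact (CPInfty.continuous_ofFin N).comp
    (Continuous.subtype_mk (continuous_pi fun i => continuous_coeff_configPoly _) _)

/-- The point `1` of the boundary circle. -/
def discOne : ClosedDisc := ⟨1, by simp⟩

theorem discOne_mem : discOne ∈ discBoundary := by
  change ‖(1 : ℂ)‖ = 1
  simp

theorem CPInfty.mem_range_ofConfig_iff {N : ℕ} {x : CPInfty} :
    x ∈ range (fun y : Fin N → ClosedDisc => CPInfty.ofConfig (tupleConfig y)) ↔
      ∃ p hp, p.natDegree ≤ N ∧ x = CPInfty.ofPoly p hp := by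
  constructor
  · rintro ⟨y, rfl⟩
    exact ⟨_, _, (natDegree_configPoly_le _).trans (card_tupleConfig y).le, rfl⟩
  · rintro ⟨p, hp, hN, rfl⟩
    have hc : (p.roots.map discPoint).card ≤ N := by
      rw [Multiset.card_map]
      exact (card_roots' p).trans hN
    obtain ⟨y, hy⟩ := exists_tupleConfig_eq
      (p.roots.map discPoint + Multiset.replicate (N - (p.roots.map discPoint).card) discOne)
      (N := N) (by rw [Multiset.card_add, Multiset.card_replicate]; omega)
    refine ⟨y, ?_⟩
    have hy' : tupleConfig y = _ := hy
    simp only [hy']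
    rw [CPInfty.ofPoly_eq_ofConfig, CPInfty.ofConfig_eq_iff, interiorPart_add,
      interiorPart_eq_zero (ξ := Multiset.replicate _ _), add_zero]
    intro z hz
    rw [Multiset.eq_of_mem_replicate hz]
    exact discOne_mem

theorem CPInfty.monotone_range_ofConfig : Monotone fun N : ℕ =>
    range (fun y : Fin N → ClosedDisc => CPInfty.ofConfig (tupleConfig y)) := by
  intro M N hMN x hx
  obtain ⟨p, hp, hM, rfl⟩ := CPInfty.mem_range_ofConfig_iff.mp hx
  exact CPInfty.mem_range_ofConfig_iff.mpr ⟨p, hp, hM.trans hMN, rfl⟩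

theorem CPInfty.ofFin_mem_range_ofConfig (N : ℕ) (v : {v : Fin (N + 1) → ℂ // v ≠ 0}) :
    CPInfty.ofFin N v ∈
      range (fun y : Fin N → ClosedDisc => CPInfty.ofConfig (tupleConfig y)) := by
  refine CPInfty.mem_range_ofConfig_iff.mpr
    ⟨⟨⟨extendByZero v.1⟩⟩, fun h => extendByZero_ne_zero v.2 ?_, ?_, rfl⟩
  · ext n
    exact congrArg (fun q : ℂ[X] => q.coeff n) h
  · refine natDegree_le_iff_coeff_eq_zero.mpr fun n hn => ?_
    change extendByZero v.1 n = 0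
    rw [extendByZero_apply, dif_neg (by omega)]

/-- The weak topology of `ℂP^∞` with respect to the images of the powers of the closed disc: this
holds as these images are compact, hence closed. -/
theorem CPInfty.isOpen_of_isOpen_preimage_ofConfig (V : Set CPInfty)
    (hV : ∀ N, IsOpen ((fun y : Fin N → ClosedDisc => CPInfty.ofConfig (tupleConfig y)) ⁻¹' V)) :
    IsOpen V := by
  refine CPInfty.isOpen_iff.mpr fun N => ?_
  set T := fun y : Fin N → ClosedDisc => CPInfty.ofConfig (tupleConfig y) with hT
  have h1 : IsClosed (T '' (T ⁻¹' V)ᶜ) :=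
    ((hV N).isClosed_compl.isCompact.image (CPInfty.continuous_ofConfig_tuple N)).isClosed
  have h2 : (CPInfty.ofFin N ⁻¹' V)ᶜ = CPInfty.ofFin N ⁻¹' (T '' (T ⁻¹' V)ᶜ) := by
    ext v
    constructor
    · intro hv
      obtain ⟨y, hy⟩ := CPInfty.ofFin_mem_range_ofConfig N v
      exact ⟨y, fun h => hv (by rw [mem_preimage, ← hy]; exact h), hy⟩
    · rintro ⟨y, hy, hyv⟩ hv
      refine hy ?_
      rw [mem_preimage, hyv]
      exact hv
  rw [← isClosed_compl_iff, h2]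
  exact h1.preimage (CPInfty.continuous_ofFin N)

/-- A set in a finite power of `ℂP^∞` is open if its preimages in the corresponding powers of powers
of the closed disc are. -/
theorem CPInfty.isOpen_pi {ι : Type*} [Finite ι] (O : Set (ι → CPInfty))
    (hO : ∀ N : ℕ, IsOpen
      {y : ι → Fin N → ClosedDisc | (fun i => CPInfty.ofConfig (tupleConfig (y i))) ∈ O}) :
    IsOpen O := by
  refine isOpen_pi_of_isOpen_preimage
    (fun (N : ℕ) (y : Fin N → ClosedDisc) => CPInfty.ofConfig (tupleConfig y))
    CPInfty.continuous_ofConfig_tuple CPInfty.monotone_range_ofConfig (fun x => ?_)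
    CPInfty.isOpen_of_isOpen_preimage_ofConfig O hO
  obtain ⟨p, hp, rfl⟩ := x.exists_ofPoly
  exact ⟨p.natDegree, CPInfty.mem_range_ofConfig_iff.mpr ⟨p, hp, le_rfl, rfl⟩⟩

end

/-! ### Spaces of tuples of configurations as quotients of spaces of ordered tuples -/

theorem exists_perm_of_map_univ_eq {α X : Type*} [Fintype α] {x y : α → X}
    (h : Multiset.map x Finset.univ.val = Multiset.map y Finset.univ.val) :
    ∃ e : Equiv.Perm α, x = y ∘ e := by
  classical
  have hc : ∀ a, Nonempty ({j // x j = a} ≃ {j // y j = a}) := by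
    intro a
    refine ⟨Fintype.equivOfCardEq ?_⟩
    have h1 := congrArg (Multiset.count a) h
    rw [Multiset.count_map, Multiset.count_map] at h1
    rw [Fintype.card_subtype, Fintype.card_subtype]
    simpa only [eq_comm (a := a), Finset.card_def, Finset.filter_val] using h1
  let g := fun a => (hc a).some
  refine ⟨(Equiv.sigmaFiberEquiv x).symm.trans
    ((Equiv.sigmaCongrRight g).trans (Equiv.sigmaFiberEquiv y)), funext fun j => ?_⟩
  exact (g (x j) ⟨j, rfl⟩).2.symm

theorem SymProd.isOpenQuotientMap_mk {X : Type*} [TopologicalSpace X] (d : ℕ) :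
    IsOpenQuotientMap (SymProd.mk : (Fin d → X) → SymProd X d) where
  surjective := by
    rintro ⟨s, hs⟩
    obtain ⟨x, hx⟩ := exists_tupleConfig_eq s hs
    exact ⟨x, Subtype.ext hx⟩
  continuous := continuous_coinduced_rng
  isOpenMap := by
    intro V hV
    change IsOpen (SymProd.mk ⁻¹' (SymProd.mk '' V))
    have h : (SymProd.mk ⁻¹' (SymProd.mk '' V) : Set (Fin d → X)) =
        ⋃ e : Equiv.Perm (Fin d), (fun x => x ∘ e) ⁻¹' V := by
      ext x
      simp only [mem_preimage, mem_image, mem_iUnion]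
      constructor
      · rintro ⟨y, hy, hyx⟩
        obtain ⟨e, he⟩ := exists_perm_of_map_univ_eq (x := y) (y := x) (congrArg Subtype.val hyx)
        exact ⟨e, by rwa [he] at hy⟩
      · rintro ⟨e, he⟩
        refine ⟨x ∘ e, he, Subtype.ext ?_⟩
        simp only [SymProd.mk]
        rw [← Multiset.map_map, Multiset.map_univ_val_equiv]
    rw [h]
    exact isOpen_iUnion fun e => hV.preimage (continuous_pi fun j => continuous_apply (e j))

section
variable {ι : Type*} (K : Set (Finset ι))

/-- The space of tuples of ordered configurations in the closed disc whose unordered configurations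
satisfy the intersection conditions of `ConfTuple`. -/
def orderedConfTuples (d : ι → ℕ) : Set (∀ i, Fin (d i) → ClosedDisc) :=
  Pi.map (fun _ => SymProd.mk) ⁻¹'
    {ξ | ∀ σ : Finset ι, σ ∉ K → ¬ ∃ x : ClosedDisc, ∀ i ∈ σ, x ∈ (ξ i).points}

variable {K}

theorem mem_orderedConfTuples {d : ι → ℕ} {x : ∀ i, Fin (d i) → ClosedDisc} :
    x ∈ orderedConfTuples K d ↔ ∀ σ : Finset ι, σ ∉ K → ¬ ∃ z, ∀ i ∈ σ, ∃ j, x i j = z := by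
  have h : ∀ (z : ClosedDisc) i, z ∈ (SymProd.mk (x i)).points ↔ ∃ j, x i j = z :=
    fun z i => mem_tupleConfig (x := x i)
  simp only [← h]
  rfl

theorem isOpen_orderedConfTuples [Finite ι] (d : ι → ℕ) : IsOpen (orderedConfTuples K d) := by
  have h : orderedConfTuples K d = ⋂ σ : Finset ι, ⋂ _ : σ ∉ K,
      (Prod.fst '' {p : (∀ i, Fin (d i) → ClosedDisc) × ClosedDisc |
        ∀ i ∈ σ, ∃ j, p.1 i j = p.2})ᶜ := by
    ext x
    simp [mem_orderedConfTuples]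
  rw [h]
  refine isOpen_iInter_of_finite fun σ => isOpen_iInter_of_finite fun _ =>
    (isClosedMap_fst_of_compactSpace _ ?_).isOpen_compl
  simp only [ofPred_forall, ofPred_exists]
  refine isClosed_iInter fun i => isClosed_iInter fun _ => isClosed_iUnion_of_finite fun j =>
    isClosed_eq ?_ continuous_snd
  exact (continuous_apply j).comp ((continuous_apply i).comp continuous_fst)

variable {D : ι → ℕ}

/-- The points in the open disc of an element of `E(X, A)`, where `X` is the closed disc and `A` its
boundary. -/
noncomputable def stableOutside (e : StableRelConfTuple K ClosedDisc discBoundary D) :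
    ι → Multiset ClosedDisc :=
  Quotient.lift (fun p : (Σ k : ℕ, RelConfTuple K ClosedDisc discBoundary (fun i => D i + k)) =>
    p.2.outside) (fun _ _ h => h) e

theorem stableOutside_injective :
    Function.Injective (stableOutside (K := K) (D := D)) := by
  intro e e'
  induction e using Quotient.inductionOn
  induction e' using Quotient.inductionOn
  exact fun h => Quotient.sound h

variable (K D) in
/-- The map sending tuples of ordered configurations to the elements of `E(X, A)` that they
represent. -/
noncomputable def ofOrdered (p : Σ k : ℕ, orderedConfTuples K (fun i => D i + k)) :
    StableRelConfTuple K ClosedDisc discBoundary D :=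
  Quotient.mk _ ⟨p.1, Quotient.mk _ (restrictPreimage _ (Pi.map fun _ => SymProd.mk) p.2)⟩

theorem stableOutside_ofOrdered (k : ℕ) (x : orderedConfTuples K (fun i => D i + k)) (i : ι) :
    stableOutside (ofOrdered K D ⟨k, x⟩) i = interiorPart (tupleConfig (x.1 i)) := rfl

theorem isQuotientMap_sigmaMap {α : Type*} {X Y : α → Type*} [∀ a, TopologicalSpace (X a)]
    [∀ a, TopologicalSpace (Y a)] {f : ∀ a, X a → Y a} (hf : ∀ a, IsQuotientMap (f a)) :
    IsQuotientMap (Sigma.map id f) := by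
  refine ⟨isCoinducing_iff.mpr fun s => ?_, ?_⟩
  rotate_left
  · rintro ⟨a, y⟩
    obtain ⟨x, rfl⟩ := (hf a).surjective y
    exact ⟨⟨a, x⟩, rfl⟩
  · rw [isOpen_sigma_iff, isOpen_sigma_iff]
    exact forall_congr' fun a => (hf a).isOpen_preimage (s := Sigma.mk a ⁻¹' s)

theorem isQuotientMap_ofOrdered : IsQuotientMap (ofOrdered K D) := by
  have h1 : ∀ k : ℕ, IsQuotientMap fun x : orderedConfTuples K (fun i => D i + k) =>
      (Quotient.mk _ (restrictPreimage _ (Pi.map fun _ => SymProd.mk) x) :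
        RelConfTuple K ClosedDisc discBoundary (fun i => D i + k)) := fun k =>
    isQuotientMap_quotient_mk'.comp
      ((IsOpenQuotientMap.piMap fun i =>
        SymProd.isOpenQuotientMap_mk (D i + k)).restrictPreimage _).isQuotientMap
  exact isQuotientMap_quotient_mk'.comp (isQuotientMap_sigmaMap h1)

/-! ### Maps into the stable space of tuples of configurations -/

/-- A family of tuples of configurations in the open disc defines a continuous map to `E(X, A)` if,
near each point `y₀`, it is the interior part of a family of ordered tuples that is continuous at
`y₀` and satisfies the intersection conditions at `y₀`. The conditions may be checked at `y₀` only,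
as they are open. -/
theorem exists_continuous_of_ordered_lifts [Finite ι] {Y : Type*} [TopologicalSpace Y]
    (γ : Y → ι → Multiset ClosedDisc)
    (h : ∀ y₀, ∃ (k : ℕ) (x : Y → ∀ i, Fin (D i + k) → ClosedDisc), ContinuousAt x y₀ ∧
      x y₀ ∈ orderedConfTuples K (fun i => D i + k) ∧
      ∀ᶠ y in 𝓝 y₀, ∀ i, interiorPart (tupleConfig (x y i)) = γ y i) :
    ∃ G : Y → StableRelConfTuple K ClosedDisc discBoundary D,
      Continuous G ∧ ∀ y, stableOutside (G y) = γ y := by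
  classical
  have hex : ∀ y, ∃ e : StableRelConfTuple K ClosedDisc discBoundary D,
      stableOutside e = γ y := by
    intro y
    obtain ⟨k, x, -, hx, he⟩ := h y
    refine ⟨ofOrdered K D ⟨k, x y, hx⟩, funext fun i => ?_⟩
    rw [stableOutside_ofOrdered]
    exact he.self_of_nhds i
  choose G hG using hex
  refine ⟨G, continuous_iff_continuousAt.mpr fun y₀ => ?_, hG⟩
  obtain ⟨k, x, hxc, hx, he⟩ := h y₀
  let x' : Y → orderedConfTuples K (fun i => D i + k) := fun y =>
    if hy : x y ∈ orderedConfTuples K (fun i => D i + k) then ⟨x y, hy⟩ else ⟨x y₀, hx⟩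
  have hmem : ∀ᶠ y in 𝓝 y₀, x y ∈ orderedConfTuples K (fun i => D i + k) :=
    hxc.eventually_mem ((isOpen_orderedConfTuples _).mem_nhds hx)
  have hx' : ∀ᶠ y in 𝓝 y₀, (x' y).1 = x y := by
    filter_upwards [hmem] with y hy
    simp only [x', dif_pos hy]
  have hc : ContinuousAt x' y₀ :=
    IsInducing.subtypeVal.continuousAt_iff.mpr (hxc.congr (hx'.mono fun y hy => hy.symm))
  have hq : Continuous fun x => ofOrdered K D ⟨k, x⟩ :=
    isQuotientMap_ofOrdered.continuous.comp continuous_sigmaMk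
  refine (hq.continuousAt.comp hc).congr ?_
  filter_upwards [hx', he] with y hy hey
  refine stableOutside_injective (funext fun i => ?_)
  simp only [Function.comp_apply]
  rw [stableOutside_ofOrdered, hG, hy, hey]

theorem infinite_discBoundary : discBoundary.Infinite := by
  have h1 : (Metric.sphere (0 : ℂ) 1).Infinite := by
    refine (isPreconnected_sphere (by simp [Complex.rank_real_complex]) 0 1).infinite_of_nontrivial
      ⟨1, by simp, -1, by simp, ?_⟩
    norm_num
  have h2 : discBoundary = ((↑) : ClosedDisc → ℂ) ⁻¹' Metric.sphere (0 : ℂ) 1 := by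
    ext z
    simp [discBoundary]
  rw [h2]
  refine h1.preimage ?_
  rw [Subtype.range_coe]
  exact Metric.sphere_subset_closedBall

theorem exists_generic_boundary_points [Finite ι] {F : Set ClosedDisc} (hF : F.Finite) :
    ∃ b : ι → ℕ → ClosedDisc, (∀ i j, b i j ∈ discBoundary) ∧ (∀ i j, b i j ∉ F) ∧
      ∀ i j i' j', b i j = b i' j' → i = i' := by
  have := (infinite_discBoundary.sdiff hF).to_subtype
  let f := Infinite.natEmbedding (discBoundary \ F : Set ClosedDisc)
  obtain ⟨g, hg⟩ := Countable.exists_injective_nat (ι × ℕ)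
  refine ⟨fun i j => f (g (i, j)), fun i j => (f _).2.1, fun i j => (f _).2.2,
    fun i j i' j' h => ?_⟩
  exact congrArg Prod.fst (hg (f.injective (Subtype.ext h)))

/-- If some entries of a tuple of configurations are replaced by generic points, then common points
for a set of indices outside `K` only arise from the other entries. -/
theorem exists_of_common_point_ite (hlow : IsLowerSet K) (hsingle : ∀ i, {i} ∈ K)
    {d : ι → ℕ} {F : Set ClosedDisc} {b : ι → ℕ → ClosedDisc} (hbF : ∀ i j, b i j ∉ F)
    (hb : ∀ i j i' j', b i j = b i' j' → i = i') {P : ∀ i, Fin (d i) → Prop}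
    [∀ i j, Decidable (P i j)] {y : ∀ i, Fin (d i) → ClosedDisc}
    (hy : ∀ i j, ¬ P i j → y i j ∈ F) {σ : Finset ι} (hσ : σ ∉ K) {z : ClosedDisc}
    (hz : ∀ i ∈ σ, ∃ j, (if P i j then b i j else y i j) = z) :
    ∀ i ∈ σ, ∃ j, ¬ P i j ∧ y i j = z := by
  intro i hi
  obtain ⟨j, hj⟩ := hz i hi
  by_cases hP : P i j
  · rw [if_pos hP] at hj
    obtain ⟨i', hi', hne⟩ : ∃ i' ∈ σ, i' ≠ i := by
      by_contra! h
      exact hσ (hlow (fun a ha => Finset.mem_singleton.mpr (h a ha)) (hsingle i))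
    obtain ⟨j', hj'⟩ := hz i' hi'
    by_cases hP' : P i' j'
    · rw [if_pos hP', ← hj] at hj'
      exact absurd (hb _ _ _ _ hj') hne
    · rw [if_neg hP', ← hj] at hj'
      exact absurd (hj' ▸ hy i' j' hP') (hbF i j)
  · rw [if_neg hP] at hj
    exact ⟨j, hP, hj⟩

theorem interiorPart_map_congr {α : Type*} {f g : α → ClosedDisc}
    (h : ∀ a, f a = g a ∨ (f a ∈ discBoundary ∧ g a ∈ discBoundary)) (s : Multiset α) :
    interiorPart (s.map f) = interiorPart (s.map g) := by
  induction s using Multiset.induction_on with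
  | empty => rfl
  | cons a s ih =>
    rw [Multiset.map_cons, Multiset.map_cons]
    rcases h a with h | ⟨h1, h2⟩
    · by_cases ha : f a ∈ discBoundary
      · rw [← h, interiorPart_cons_of_mem ha, interiorPart_cons_of_mem ha, ih]
      · rw [← h, interiorPart_cons_of_notMem ha, interiorPart_cons_of_notMem ha, ih]
    · rw [interiorPart_cons_of_mem h1, interiorPart_cons_of_mem h2, ih]

/-! ### Radial expansion of the disc -/

/-- The radial expansion of the disc by the factor `1 / lam`, where points leaving the disc stop at
the boundary circle. -/
noncomputable def pushOut (lam : ℝ) (z : ClosedDisc) : ClosedDisc :=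
  ⟨(z : ℂ) / ((max lam ‖(z : ℂ)‖ : ℝ) : ℂ), by
    rw [mem_closedBall_zero_iff, norm_div, Complex.norm_real]
    exact div_le_one_of_le₀ ((le_max_right _ _).trans (le_abs_self _)) (norm_nonneg _)⟩

theorem continuousAt_pushOut {p : ℝ × ClosedDisc} (hp : 0 < p.1) :
    ContinuousAt (fun p : ℝ × ClosedDisc => pushOut p.1 p.2) p := by
  refine IsInducing.subtypeVal.continuousAt_iff.mpr ?_
  have hz : Continuous fun p : ℝ × ClosedDisc => (p.2 : ℂ) :=
    continuous_subtype_val.comp continuous_snd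
  refine ContinuousAt.div hz.continuousAt (Complex.continuous_ofReal.comp
    (continuous_fst.max (continuous_norm.comp hz))).continuousAt ?_
  exact Complex.ofReal_ne_zero.mpr (lt_max_of_lt_left hp).ne'

theorem pushOut_mem_iff {lam : ℝ} (h : 0 < lam) {z : ClosedDisc} :
    pushOut lam z ∈ discBoundary ↔ lam ≤ ‖(z : ℂ)‖ := by
  have h0 : 0 < max lam ‖(z : ℂ)‖ := lt_max_of_lt_left h
  change ‖(z : ℂ) / ((max lam ‖(z : ℂ)‖ : ℝ) : ℂ)‖ = 1 ↔ _
  rw [norm_div, Complex.norm_real, Real.norm_of_nonneg h0.le, div_eq_one_iff_eq h0.ne']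
  exact eq_comm.trans max_eq_right_iff

theorem pushOut_one (z : ClosedDisc) : pushOut 1 z = z := by
  apply Subtype.ext
  simp [pushOut, max_eq_left z.norm_le_one]

theorem mul_pushOut {lam : ℝ} (h : 0 < lam) {z : ClosedDisc} (hz : ‖(z : ℂ)‖ ≤ lam) :
    (lam : ℂ) * pushOut lam z = z := by
  simp only [pushOut]
  rw [max_eq_left hz, mul_div_cancel₀]
  exact Complex.ofReal_ne_zero.mpr h.ne'

theorem interiorPart_map_pushOut {lam : ℝ} (h0 : 0 < lam) (h1 : lam ≤ 1)
    (ξ : Multiset ClosedDisc) :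
    interiorPart ((interiorPart ξ).map (pushOut lam)) = interiorPart (ξ.map (pushOut lam)) := by
  induction ξ using Multiset.induction_on with
  | empty => simp
  | cons z ξ ih =>
    by_cases hz : z ∈ discBoundary
    · have h : pushOut lam z ∈ discBoundary :=
        (pushOut_mem_iff h0).mpr (h1.trans (show ‖(z : ℂ)‖ = 1 from hz).ge)
      rw [interiorPart_cons_of_mem hz, Multiset.map_cons, interiorPart_cons_of_mem h, ih]
    · rw [interiorPart_cons_of_notMem hz, Multiset.map_cons, Multiset.map_cons]
      by_cases h : pushOut lam z ∈ discBoundary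
      · rw [interiorPart_cons_of_mem h, interiorPart_cons_of_mem h, ih]
      · rw [interiorPart_cons_of_notMem h, interiorPart_cons_of_notMem h, ih]

open NNReal

/-- The product of the norms of the points of a configuration. It vanishes exactly if the origin is
one of the points, it does not see points of the boundary circle, and it is a lower bound for the
norms of the points. -/
noncomputable def normProd (ξ : Multiset ClosedDisc) : ℝ≥0 := (ξ.map fun z : ClosedDisc => ‖(z : ℂ)‖₊).prod

@[simp] theorem normProd_zero : normProd 0 = 1 := by simp [normProd]

theorem normProd_cons (z : ClosedDisc) (ξ : Multiset ClosedDisc) :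
    normProd (z ::ₘ ξ) = ‖(z : ℂ)‖₊ * normProd ξ := by simp [normProd]

theorem normProd_le_one (ξ : Multiset ClosedDisc) : normProd ξ ≤ 1 := by
  induction ξ using Multiset.induction_on with
  | empty => simp
  | cons z ξ ih =>
    rw [normProd_cons]
    exact mul_le_one' z.norm_le_one ih

theorem normProd_interiorPart (ξ : Multiset ClosedDisc) :
    normProd (interiorPart ξ) = normProd ξ := by
  induction ξ using Multiset.induction_on with
  | empty => simp
  | cons z ξ ih =>
    by_cases hz : z ∈ discBoundary
    · have h : ‖(z : ℂ)‖₊ = 1 := NNReal.eq hz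
      rw [interiorPart_cons_of_mem hz, normProd_cons, h, one_mul, ih]
    · rw [interiorPart_cons_of_notMem hz, normProd_cons, normProd_cons, ih]

theorem normProd_le_norm {ξ : Multiset ClosedDisc} {z : ClosedDisc} (hz : z ∈ ξ) :
    normProd ξ ≤ ‖(z : ℂ)‖₊ := by
  obtain ⟨ξ, rfl⟩ := Multiset.exists_cons_of_mem hz
  rw [normProd_cons]
  exact mul_le_of_le_one_right' (normProd_le_one ξ)

theorem exists_eq_zero_of_normProd_eq_zero {ξ : Multiset ClosedDisc} (h : normProd ξ = 0) :
    ∃ z ∈ ξ, (z : ℂ) = 0 := by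
  obtain ⟨z, hz, h0⟩ := Multiset.mem_map.mp
    (Multiset.prod_eq_zero_iff.mp (show (ξ.map fun z : ClosedDisc => ‖(z : ℂ)‖₊).prod = 0 from h))
  exact ⟨z, hz, nnnorm_eq_zero.mp h0⟩

theorem continuous_normProd_tuple (N : ℕ) :
    Continuous fun x : Fin N → ClosedDisc => normProd (tupleConfig x) := by
  simp only [normProd, tupleConfig, Multiset.map_map]
  exact continuous_finsetProd (Finset.univ : Finset (Fin N)) fun j _ =>
    continuous_nnnorm.comp (continuous_subtype_val.comp (continuous_apply j))

variable [Fintype ι]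

open Classical in
variable (K) in
/-- A radius such that the configurations of `ζ` that have points of smaller norm form a simplex of
`K`. It is positive if no set of configurations outside `K` has the origin as a common point. -/
noncomputable def simplexRadius (ζ : ι → Multiset ClosedDisc) : ℝ≥0 :=
  ∏ σ : Finset ι with σ ∉ K, σ.sup fun i => normProd (ζ i)

theorem simplexRadius_interiorPart (ζ : ι → Multiset ClosedDisc) :
    simplexRadius K (fun i => interiorPart (ζ i)) = simplexRadius K ζ := by
  simp only [simplexRadius, normProd_interiorPart]

theorem simplexRadius_le (ζ : ι → Multiset ClosedDisc) {σ : Finset ι} (hσ : σ ∉ K) :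
    simplexRadius K ζ ≤ σ.sup fun i => normProd (ζ i) := by
  classical
  unfold simplexRadius
  rw [← Finset.mul_prod_erase _ _
    (Finset.mem_filter.mpr ⟨Finset.mem_univ σ, hσ⟩ : σ ∈ Finset.univ.filter (· ∉ K))]
  exact mul_le_of_le_one_right' (Finset.prod_le_one' fun τ _ =>
    Finset.sup_le fun i _ => normProd_le_one _)

theorem simplexRadius_le_one (ζ : ι → Multiset ClosedDisc) : simplexRadius K ζ ≤ 1 :=
  Finset.prod_le_one' fun _ _ => Finset.sup_le fun _ _ => normProd_le_one _

theorem simplexRadius_eq_one (hlow : IsLowerSet K) {ζ : ι → Multiset ClosedDisc} {σ : Finset ι}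
    (hσ : σ ∈ K) (h : ∀ i, i ∉ σ → ζ i = 0) : simplexRadius K ζ = 1 := by
  classical
  refine Finset.prod_eq_one fun τ hτ => le_antisymm
    (Finset.sup_le fun _ _ => normProd_le_one _) ?_
  obtain ⟨i, hi, hiσ⟩ : ∃ i ∈ τ, i ∉ σ := by
    by_contra! h'
    exact (Finset.mem_filter.mp hτ).2 (hlow h' hσ)
  have := Finset.le_sup (f := fun i => normProd (ζ i)) hi
  simpa [h i hiσ] using this

/-- For `∅ ∉ K`, where the empty supremum is a factor of the radius, there are no tuples `x` as
required. -/
theorem simplexRadius_pos {d : ι → ℕ} {x : ∀ i, Fin (d i) → ClosedDisc}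
    (hx : x ∈ orderedConfTuples K d) : 0 < simplexRadius K (fun i => tupleConfig (x i)) := by
  classical
  refine Finset.prod_pos fun σ hσ => ?_
  by_contra h
  have h0 := le_antisymm (not_lt.mp h) (zero_le)
  have hσ' := (Finset.mem_filter.mp hσ).2
  refine mem_orderedConfTuples.mp hx σ hσ' ⟨⟨0, by simp⟩, fun i hi => ?_⟩
  have h1 : normProd (tupleConfig (x i)) = 0 := le_antisymm
    (h0 ▸ Finset.le_sup (f := fun i => normProd (tupleConfig (x i))) hi) (zero_le)
  obtain ⟨z, hz, hz0⟩ := exists_eq_zero_of_normProd_eq_zero h1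
  obtain ⟨j, rfl⟩ := mem_tupleConfig.mp hz
  exact ⟨j, Subtype.ext hz0⟩

theorem continuous_simplexRadius (d : ι → ℕ) :
    Continuous fun x : ∀ i, Fin (d i) → ClosedDisc =>
      simplexRadius K (fun i => tupleConfig (x i)) := by
  refine continuous_finsetProd _ fun σ _ => Continuous.finset_sup_apply fun i _ => ?_
  exact (continuous_normProd_tuple _).comp (continuous_apply i)

end

section
variable {ι : Type*} {K : Set (Finset ι)} {D : ι → ℕ}

/-! ### Expanding tuples of configurations -/

variable (K) in
/-- The radius that is moved to the boundary circle at time `t` of the radial expansion of `ζ`. -/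
noncomputable def expansionRadius [Fintype ι] (ζ : ι → Multiset ClosedDisc) (t : unitInterval) :
    ℝ :=
  (1 - t) + t * (simplexRadius K ζ : ℝ)

section
variable [Fintype ι]

theorem expansionRadius_pos {ζ : ι → Multiset ClosedDisc} (h : 0 < simplexRadius K ζ)
    (t : unitInterval) : 0 < expansionRadius K ζ t := by
  have h' : (0 : ℝ) < simplexRadius K ζ := h
  unfold expansionRadius
  rcases t.2.2.lt_or_eq with ht | ht
  · have := mul_nonneg t.2.1 h'.le
    linarith
  · rw [ht]; linarith

theorem expansionRadius_le_one (ζ : ι → Multiset ClosedDisc) (t : unitInterval) :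
    expansionRadius K ζ t ≤ 1 := by
  have h' : (simplexRadius K ζ : ℝ) ≤ 1 := simplexRadius_le_one ζ
  have := mul_le_mul_of_nonneg_left h' t.2.1
  unfold expansionRadius
  linarith

variable (K) in
/-- The radial expansion of a tuple of configurations at time `t`. -/
noncomputable def expandConfig (ζ : ι → Multiset ClosedDisc) (t : unitInterval) (i : ι) :
    Multiset ClosedDisc :=
  interiorPart ((ζ i).map (pushOut (expansionRadius K ζ t)))

theorem expandConfig_interiorPart {ζ : ι → Multiset ClosedDisc} (h : 0 < simplexRadius K ζ)
    (t : unitInterval) :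
    expandConfig K (fun i => interiorPart (ζ i)) t = expandConfig K ζ t := by
  have h1 : expansionRadius K (fun i => interiorPart (ζ i)) t = expansionRadius K ζ t := by
    simp only [expansionRadius, simplexRadius_interiorPart]
  funext i
  simp only [expandConfig, h1]
  exact interiorPart_map_pushOut (expansionRadius_pos h t) (expansionRadius_le_one ζ t) _

theorem expandConfig_eq_self {ζ : ι → Multiset ClosedDisc} {t : unitInterval}
    (h : expansionRadius K ζ t = 1) (i : ι) : expandConfig K ζ t i = interiorPart (ζ i) := by
  simp only [expandConfig, h, pushOut_one, Multiset.map_id']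

theorem continuous_expansionRadius (d : ι → ℕ) :
    Continuous fun p : (∀ i, Fin (d i) → ClosedDisc) × unitInterval =>
      expansionRadius K (fun i => tupleConfig (p.1 i)) p.2 := by
  have h1 : Continuous fun p : (∀ i, Fin (d i) → ClosedDisc) × unitInterval => (p.2 : ℝ) :=
    continuous_subtype_val.comp continuous_snd
  exact (continuous_const.sub h1).add (h1.mul (NNReal.continuous_coe.comp
    ((continuous_simplexRadius d).comp continuous_fst)))

/-- The radial expansion of ordered tuples defines a continuous map to `E(X, A)`. Points that are
moved across the boundary circle could collide with other points there. They are therefore placed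
at generic points of the boundary circle instead, which does not change their class. -/
theorem exists_continuous_expand_ordered (hlow : IsLowerSet K) (hsingle : ∀ i, {i} ∈ K) (k : ℕ) :
    ∃ G : orderedConfTuples K (fun i => D i + k) × unitInterval →
        StableRelConfTuple K ClosedDisc discBoundary D,
      Continuous G ∧
        ∀ p, stableOutside (G p) = expandConfig K (fun i => tupleConfig (p.1.1 i)) p.2 := by
  classical
  refine exists_continuous_of_ordered_lifts _ ?_
  rintro ⟨x₀, t₀⟩
  let lam : orderedConfTuples K (fun i => D i + k) × unitInterval → ℝ := fun p =>
    expansionRadius K (fun i => tupleConfig (p.1.1 i)) p.2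
  have hlam : Continuous lam :=
    (continuous_expansionRadius _).comp (continuous_subtype_val.prodMap continuous_id)
  have hpos : ∀ p, 0 < lam p := fun p => expansionRadius_pos (simplexRadius_pos p.1.2) p.2
  set lam₀ := lam (x₀, t₀) with hlam₀
  obtain ⟨b, hbA, hbF, hb⟩ := exists_generic_boundary_points (ι := ι)
    (F := range fun q : (Σ i, Fin (D i + k)) => pushOut lam₀ (x₀.1 q.1 q.2)) (finite_range _)
  have hxc : ∀ i j, Continuous fun p : orderedConfTuples K (fun i => D i + k) × unitInterval =>
      p.1.1 i j := fun i j => (continuous_apply j).comp ((continuous_apply i).comp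
        (continuous_subtype_val.comp continuous_fst))
  refine ⟨k, fun p i j => if lam₀ < ‖(x₀.1 i j : ℂ)‖ then b i j
    else pushOut (lam p) (p.1.1 i j), ?_, ?_, ?_⟩
  · refine continuousAt_pi.mpr fun i => continuousAt_pi.mpr fun j => ?_
    split_ifs with h
    · exact continuousAt_const
    · exact ContinuousAt.comp (f := fun p => (lam p, p.1.1 i j))
        (g := fun p : ℝ × ClosedDisc => pushOut p.1 p.2) (continuousAt_pushOut (hpos _))
        (hlam.prodMk (hxc i j)).continuousAt
  · refine mem_orderedConfTuples.mpr ?_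
    rintro σ hσ ⟨z, hz⟩
    have h := exists_of_common_point_ite (d := fun i => D i + k)
      (P := fun i j => lam₀ < ‖(x₀.1 i j : ℂ)‖)
      (y := fun i j => pushOut lam₀ (x₀.1 i j)) hlow hsingle hbF hb
      (fun i j _ => ⟨⟨i, j⟩, rfl⟩) hσ hz
    -- A common point after the expansion that is not generic was a common point before.
    have hz' : ∀ i ∈ σ, ∃ j, (x₀.1 i j : ℂ) = lam₀ * z := by
      intro i hi
      obtain ⟨j, hj, hjz⟩ := h i hi
      exact ⟨j, by rw [← hjz, mul_pushOut (hpos _) (not_lt.mp hj)]⟩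
    rcases σ.eq_empty_or_nonempty with rfl | ⟨i, hi⟩
    · exact mem_orderedConfTuples.mp x₀.2 ∅ hσ ⟨z, by simp⟩
    · obtain ⟨j, hj⟩ := hz' i hi
      refine mem_orderedConfTuples.mp x₀.2 σ hσ ⟨x₀.1 i j, fun i' hi' => ?_⟩
      obtain ⟨j', hj'⟩ := hz' i' hi'
      exact ⟨j', Subtype.ext (hj'.trans hj.symm)⟩
    -- Points that are strictly outside at time `t₀` stay on the boundary circle nearby.
  · have h : ∀ i j, ∀ᶠ p in 𝓝 (x₀, t₀), lam₀ < ‖(x₀.1 i j : ℂ)‖ →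
        lam p ≤ ‖(p.1.1 i j : ℂ)‖ := by
      intro i j
      by_cases h : lam₀ < ‖(x₀.1 i j : ℂ)‖
      · have h1 : Continuous fun p : orderedConfTuples K (fun i => D i + k) × unitInterval =>
            ‖(p.1.1 i j : ℂ)‖ := continuous_norm.comp (continuous_subtype_val.comp (hxc i j))
        filter_upwards [hlam.continuousAt.eventually_lt h1.continuousAt h] with p hp _
        exact hp.le
      · exact Eventually.of_forall fun p hp => absurd hp h
    filter_upwards [eventually_all.mpr fun i => eventually_all.mpr (h i)] with p hp i
    simp only [expandConfig, tupleConfig, Multiset.map_map]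
    refine interiorPart_map_congr (fun j => ?_) _
    simp only [Function.comp_apply]
    split_ifs with hj
    · exact Or.inr ⟨hbA i j, (pushOut_mem_iff (hpos p)).mpr (hp i j hj)⟩
    · exact Or.inl rfl

theorem simplexRadius_stableOutside_pos
    (e : StableRelConfTuple K ClosedDisc discBoundary D) :
    0 < simplexRadius K (stableOutside e) := by
  obtain ⟨⟨k, x⟩, rfl⟩ := isQuotientMap_ofOrdered.surjective e
  have h : stableOutside (ofOrdered K D ⟨k, x⟩) =
      fun i => interiorPart (tupleConfig (x.1 i)) := rfl
  rw [h, simplexRadius_interiorPart]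
  exact simplexRadius_pos x.2

/-- The radial expansion is a continuous deformation of `E(X, A)`. -/
theorem exists_continuous_expand (hlow : IsLowerSet K) (hsingle : ∀ i, {i} ∈ K) :
    ∃ H : StableRelConfTuple K ClosedDisc discBoundary D × unitInterval →
        StableRelConfTuple K ClosedDisc discBoundary D,
      Continuous H ∧ ∀ p, stableOutside (H p) = expandConfig K (stableOutside p.1) p.2 := by
  choose G hGc hG using exists_continuous_expand_ordered (D := D) hlow hsingle
  have hGo : ∀ k p, stableOutside (G k p) =
      expandConfig K (stableOutside (ofOrdered K D ⟨k, p.1⟩)) p.2 := by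
    intro k p
    have h : stableOutside (ofOrdered K D ⟨k, p.1⟩) =
        fun i => interiorPart (tupleConfig (p.1.1 i)) := rfl
    rw [hG, h, expandConfig_interiorPart (simplexRadius_pos p.1.2)]
  have hex : ∀ p : StableRelConfTuple K ClosedDisc discBoundary D × unitInterval,
      ∃ e : StableRelConfTuple K ClosedDisc discBoundary D,
        stableOutside e = expandConfig K (stableOutside p.1) p.2 := by
    rintro ⟨e, t⟩
    obtain ⟨⟨k, x⟩, rfl⟩ := isQuotientMap_ofOrdered.surjective e
    exact ⟨G k (x, t), hGo k (x, t)⟩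
  choose H hH using hex
  refine ⟨H, isQuotientMap_ofOrdered.continuous_lift_prod_left ?_, hH⟩
  have h : (fun p : (Σ k : ℕ, orderedConfTuples K (fun i => D i + k)) × unitInterval =>
      H (ofOrdered K D p.1, p.2)) =
      (fun q : (Σ k : ℕ, orderedConfTuples K (fun i => D i + k) × unitInterval) =>
        G q.1 q.2) ∘ Homeomorph.sigmaProdDistrib := by
    funext p
    obtain ⟨⟨k, x⟩, t⟩ := p
    refine stableOutside_injective ?_
    rw [hH]
    exact (hGo k (x, t)).symm
  rw [h]
  exact (continuous_sigma hGc).comp Homeomorph.sigmaProdDistrib.continuous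

/-- At the end of the expansion, the nonempty configurations form a simplex of `K`. -/
theorem exists_simplex_expandConfig_one {ζ : ι → Multiset ClosedDisc}
    (h : 0 < simplexRadius K ζ) : ∃ σ ∈ K, ∀ i, i ∉ σ → expandConfig K ζ 1 i = 0 := by
  classical
  refine ⟨Finset.univ.filter fun i => expandConfig K ζ 1 i ≠ 0, ?_, fun i hi => by
    simpa using hi⟩
  by_contra hσ
  have hle := simplexRadius_le ζ hσ
  obtain ⟨i, hi, hle⟩ := (Finset.le_sup_iff (show ⊥ < simplexRadius K ζ from h)).mp hle
  refine (Finset.mem_filter.mp hi).2 (interiorPart_eq_zero fun z hz => ?_)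
  obtain ⟨w, hw, rfl⟩ := Multiset.mem_map.mp hz
  refine (pushOut_mem_iff (expansionRadius_pos h 1)).mpr ?_
  have h1 : expansionRadius K ζ 1 = simplexRadius K ζ := by simp [expansionRadius]
  rw [h1]
  exact_mod_cast hle.trans (normProd_le_norm hw)

end

/-! ### The comparison with the Davis–Januszkiewicz space -/

theorem mem_polyhedralProduct_iff {X : Type*} {K : Set (Finset ι)} {a : X} {p : ι → X} :
    p ∈ polyhedralProduct K (fun _ : ι => X) (fun _ => {a}) ↔
      ∃ σ ∈ K, ∀ i, i ∉ σ → p i = a := by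
  simp [polyhedralProduct]

/-- The map from `E(X, A)` to the product of the spaces `ℂP^∞` whose components are given by the
polynomials whose roots are the points in the open disc. -/
noncomputable def toCPInfty (e : StableRelConfTuple K ClosedDisc discBoundary D) : ι → CPInfty :=
  fun i => CPInfty.ofConfig (stableOutside e i)

theorem interiorPart_stableOutside (e : StableRelConfTuple K ClosedDisc discBoundary D) (i : ι) :
    interiorPart (stableOutside e i) = stableOutside e i := by
  obtain ⟨⟨k, x⟩, rfl⟩ := isQuotientMap_ofOrdered.surjective e
  rw [stableOutside_ofOrdered, interiorPart_interiorPart]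

theorem toCPInfty_injective : Function.Injective (toCPInfty (K := K) (D := D)) := by
  intro e e' h
  refine stableOutside_injective (funext fun i => ?_)
  rw [← interiorPart_stableOutside e, ← interiorPart_stableOutside e']
  exact CPInfty.ofConfig_eq_iff.mp (congrFun h i)

theorem continuous_toCPInfty : Continuous (toCPInfty (K := K) (D := D)) := by
  refine isQuotientMap_ofOrdered.continuous_iff.mpr (continuous_sigma fun k =>
    continuous_pi fun i => ?_)
  have h : (fun x : orderedConfTuples K (fun i => D i + k) =>
      toCPInfty (ofOrdered K D ⟨k, x⟩) i) = fun x => CPInfty.ofConfig (tupleConfig (x.1 i)) := by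
    funext x
    rw [toCPInfty, CPInfty.ofConfig_eq_iff, stableOutside_ofOrdered, interiorPart_interiorPart]
  exact h ▸ (CPInfty.continuous_ofConfig_tuple _).comp
    ((continuous_apply i).comp continuous_subtype_val)

/-- The ordered tuples all of whose configurations with index outside `σ` lie on the boundary
circle. -/
def supportedTuples (σ : Finset ι) (N : ℕ) : Set (ι → Fin N → ClosedDisc) :=
  {x | ∀ i, i ∉ σ → ∀ j, x i j ∈ discBoundary}

theorem isClosed_supportedTuples (σ : Finset ι) (N : ℕ) : IsClosed (supportedTuples σ N) := by
  simp only [supportedTuples, ofPred_forall]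
  refine isClosed_iInter fun i => isClosed_iInter fun _ => isClosed_iInter fun j => ?_
  exact isClosed_eq (continuous_norm.comp (continuous_subtype_val.comp
    ((continuous_apply j).comp (continuous_apply i)))) continuous_const

theorem mem_supportedTuples_iff {σ : Finset ι} {N : ℕ} {x : ι → Fin N → ClosedDisc} :
    x ∈ supportedTuples σ N ↔
      ∀ i, i ∉ σ → CPInfty.ofConfig (tupleConfig (x i)) = CPInfty.base := by
  simp only [CPInfty.ofConfig_eq_base_iff]
  refine forall₂_congr fun i _ => ⟨fun h => interiorPart_eq_zero fun z hz => ?_, fun h j => ?_⟩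
  · obtain ⟨j, rfl⟩ := mem_tupleConfig.mp hz
    exact h j
  · by_contra hj
    have h1 : x i j ∈ interiorPart (tupleConfig (x i)) :=
      mem_interiorPart.mpr ⟨mem_tupleConfig.mpr ⟨j, rfl⟩, hj⟩
    rw [h] at h1
    exact Multiset.notMem_zero _ h1

/-- Padding a tuple with points of the boundary circle does not change its interior part. -/
theorem interiorPart_tupleConfig_pad {N M : ℕ} (hNM : N ≤ M) (x : Fin N → ClosedDisc)
    (y : Fin M → ClosedDisc) (h : ∀ j (hj : j.val < N), y j = x ⟨j, hj⟩)
    (hb : ∀ j : Fin M, N ≤ j.val → y j ∈ discBoundary) :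
    interiorPart (tupleConfig y) = interiorPart (tupleConfig x) := by
  obtain ⟨L, rfl⟩ := Nat.exists_eq_add_of_le hNM
  have h1 : y = Fin.append x (fun l => y (Fin.natAdd N l)) := by
    funext j
    refine Fin.addCases (fun j => ?_) (fun j => ?_) j
    · rw [Fin.append_left]
      exact h _ j.2
    · rw [Fin.append_right]
  have h2 : tupleConfig y = tupleConfig x + tupleConfig fun l => y (Fin.natAdd N l) := by
    conv_lhs => rw [h1]
    simp only [tupleConfig, Fin.univ_val_map, List.ofFn_fin_append]
    rfl
  rw [h2, interiorPart_add, add_eq_left]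
  refine interiorPart_eq_zero fun z hz => ?_
  obtain ⟨l, rfl⟩ := mem_tupleConfig.mp hz
  exact hb _ (by simp)

variable [Finite ι]

/-- For a simplex `σ` of `K`, all tuples of configurations whose nonempty members have indices in
`σ` satisfy the intersection conditions, and they depend continuously on their points as elements of
`E(X, A)`. Again the points of the boundary circle are replaced by generic ones. -/
theorem exists_continuous_ofSupported (hlow : IsLowerSet K) (hsingle : ∀ i, {i} ∈ K)
    {σ : Finset ι} (hσ : σ ∈ K) (N : ℕ) :
    ∃ G : supportedTuples σ N → StableRelConfTuple K ClosedDisc discBoundary D,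
      Continuous G ∧ ∀ x, stableOutside (G x) = fun i => interiorPart (tupleConfig (x.1 i)) := by
  classical
  refine exists_continuous_of_ordered_lifts _ fun x₀ => ?_
  obtain ⟨b, hbA, hbF, hb⟩ := exists_generic_boundary_points (ι := ι)
    (F := range fun q : ι × Fin N => x₀.1 q.1 q.2) (finite_range _)
  let P : ∀ i, Fin (D i + N) → Prop := fun i j => ¬ (i ∈ σ ∧ j.val < N)
  let y : supportedTuples σ N → ∀ i, Fin (D i + N) → ClosedDisc := fun x i j =>
    if h : j.val < N then x.1 i ⟨j, h⟩ else discOne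
  refine ⟨N, fun x i j => if P i j then b i j else y x i j, ?_, ?_, Eventually.of_forall ?_⟩
  · refine Continuous.continuousAt (continuous_pi fun i => continuous_pi fun j => ?_)
    by_cases hP : P i j
    · simp only [if_pos hP]
      exact continuous_const
    · have h : j.val < N := (not_not.mp hP).2
      simp only [if_neg hP, y, dif_pos h]
      exact (continuous_apply _).comp ((continuous_apply i).comp continuous_subtype_val)
  · refine mem_orderedConfTuples.mpr ?_
    rintro τ hτ ⟨z, hz⟩
    have h := exists_of_common_point_ite (P := P) (y := y x₀) hlow hsingle hbF hb
      (fun i j hP => by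
        have h : j.val < N := (not_not.mp hP).2
        exact ⟨(i, ⟨j, h⟩), by simp only [y, dif_pos h]⟩) hτ hz
    refine hτ (hlow (fun i hi => ?_) hσ)
    obtain ⟨j, hP, -⟩ := h i hi
    exact (not_not.mp hP).1
  · intro x i
    by_cases hi : i ∈ σ
    · refine interiorPart_tupleConfig_pad (Nat.le_add_left _ _) _ _ (fun j hj => ?_)
        fun j hj => ?_
      · have hP : ¬ P i j := not_not.mpr ⟨hi, hj⟩
        simp only [if_neg hP, y, dif_pos hj]
      · have hP : P i j := fun h => absurd h.2 (not_lt.mpr hj)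
        simp only [if_pos hP]
        exact hbA i j
    · rw [interiorPart_eq_zero, interiorPart_eq_zero]
      · intro z hz
        obtain ⟨j, rfl⟩ := mem_tupleConfig.mp hz
        exact x.2 i hi j
      · intro z hz
        obtain ⟨j, rfl⟩ := mem_tupleConfig.mp hz
        have hP : P i j := fun h => hi h.1
        simp only [if_pos hP]
        exact hbA i j

/-- The inverse of `toCPInfty` on the Davis–Januszkiewicz space is continuous. -/
theorem exists_continuous_ofDavisJanuszkiewicz (hlow : IsLowerSet K) (hsingle : ∀ i, {i} ∈ K) :
    ∃ g : DavisJanuszkiewicz K → StableRelConfTuple K ClosedDisc discBoundary D,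
      Continuous g ∧ ∀ p, toCPInfty (g p) = p.1 := by
  classical
  cases nonempty_fintype ι
  have hG : ∀ (σ : Finset ι) (_ : σ ∈ K) (N : ℕ), ∃ G : supportedTuples σ N →
      StableRelConfTuple K ClosedDisc discBoundary D, Continuous G ∧
        ∀ x, toCPInfty (G x) = fun i => CPInfty.ofConfig (tupleConfig (x.1 i)) := by
    intro σ hσ N
    obtain ⟨G, hGc, hG⟩ := exists_continuous_ofSupported (D := D) hlow hsingle hσ N
    refine ⟨G, hGc, fun x => funext fun i => ?_⟩
    rw [toCPInfty, CPInfty.ofConfig_eq_iff, hG, interiorPart_interiorPart]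
  choose G hG using hG
  have hex : ∀ p : DavisJanuszkiewicz K,
      ∃ e : StableRelConfTuple K ClosedDisc discBoundary D, toCPInfty e = p.1 := by
    rintro ⟨p, hp⟩
    obtain ⟨σ, hσ, hpσ⟩ := mem_polyhedralProduct_iff.mp hp
    have h1 : ∀ i, ∃ N : ℕ,
        p i ∈ range (fun y : Fin N → ClosedDisc => CPInfty.ofConfig (tupleConfig y)) := by
      intro i
      obtain ⟨q, hq, h⟩ := (p i).exists_ofPoly
      exact ⟨q.natDegree, CPInfty.mem_range_ofConfig_iff.mpr ⟨q, hq, le_rfl, h⟩⟩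
    choose N hN using h1
    have h2 : ∀ i, ∃ y : Fin (Finset.univ.sup N) → ClosedDisc,
        CPInfty.ofConfig (tupleConfig y) = p i := fun i =>
      CPInfty.monotone_range_ofConfig (Finset.le_sup (Finset.mem_univ i)) (hN i)
    choose y hy using h2
    have hyσ : y ∈ supportedTuples σ (Finset.univ.sup N) :=
      mem_supportedTuples_iff.mpr fun i hi => (hy i).trans (hpσ i hi)
    exact ⟨G σ hσ _ ⟨y, hyσ⟩, ((hG σ hσ _).2 _).trans (funext hy)⟩
  choose g hg using hex
  refine ⟨g, continuous_iff_isClosed.mpr fun C hC => ?_, hg⟩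
  let S : Set (ι → CPInfty) := {p | ∃ h : p ∈ polyhedralProduct K (fun _ : ι => CPInfty)
    (fun _ => {CPInfty.base}), g ⟨p, h⟩ ∈ C}
  have hS : g ⁻¹' C = (↑) ⁻¹' S := by
    ext p
    exact ⟨fun h => ⟨p.2, h⟩, fun h => h.2⟩
  rw [hS]
  refine IsClosed.preimage continuous_subtype_val
    (isOpen_compl_iff.mp (CPInfty.isOpen_pi Sᶜ fun N => ?_))
  have hgG : ∀ (σ : Finset ι) (hσ : σ ∈ K) (y : supportedTuples σ N) (hy : _),
      g ⟨fun i => CPInfty.ofConfig (tupleConfig (y.1 i)), hy⟩ = G σ hσ N y :=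
    fun σ hσ y hy => toCPInfty_injective (by rw [hg, (hG σ hσ N).2])
  have hSN : {y : ι → Fin N → ClosedDisc | (fun i => CPInfty.ofConfig (tupleConfig (y i))) ∈ S} =
      ⋃ σ : Finset ι, ⋃ hσ : σ ∈ K, (↑) '' (G σ hσ N ⁻¹' C) := by
    ext y
    simp only [mem_iUnion]
    constructor
    · rintro ⟨hy, hyC⟩
      obtain ⟨σ, hσ, hpσ⟩ := mem_polyhedralProduct_iff.mp hy
      refine ⟨σ, hσ, ⟨y, mem_supportedTuples_iff.mpr hpσ⟩, ?_, rfl⟩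
      rw [mem_preimage, ← hgG σ hσ _ hy]
      exact hyC
    · rintro ⟨σ, hσ, y, hyC, rfl⟩
      have hy : (fun i => CPInfty.ofConfig (tupleConfig (y.1 i))) ∈
          polyhedralProduct K (fun _ : ι => CPInfty) (fun _ => {CPInfty.base}) :=
        mem_polyhedralProduct_iff.mpr ⟨σ, hσ, mem_supportedTuples_iff.mp y.2⟩
      refine ⟨hy, ?_⟩
      rw [hgG σ hσ]
      exact hyC
  change IsOpen
    {y : ι → Fin N → ClosedDisc | (fun i => CPInfty.ofConfig (tupleConfig (y i))) ∈ S}ᶜ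
  rw [isOpen_compl_iff, hSN]
  refine isClosed_iUnion_of_finite fun σ => isClosed_iUnion_of_finite fun hσ => ?_
  exact (isClosed_supportedTuples σ N).isClosedEmbedding_subtypeVal.isClosedMap _
    (hC.preimage (hG σ hσ N).1)

/-- The end of the radial expansion, followed by `toCPInfty`, is a homotopy inverse of the inclusion
of the Davis–Januszkiewicz space; the other composition is the identity. -/
theorem nonempty_homotopyEquiv_davisJanuszkiewicz (hlow : IsLowerSet K)
    (hsingle : ∀ i, {i} ∈ K) :
    Nonempty (ContinuousMap.HomotopyEquiv (StableRelConfTuple K ClosedDisc discBoundary D)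
      (DavisJanuszkiewicz K)) := by
  cases nonempty_fintype ι
  obtain ⟨H, hHc, hH⟩ := exists_continuous_expand (D := D) hlow hsingle
  obtain ⟨g, hgc, hg⟩ := exists_continuous_ofDavisJanuszkiewicz (D := D) hlow hsingle
  have hmem : ∀ e, toCPInfty (H (e, 1)) ∈
      polyhedralProduct K (fun _ : ι => CPInfty) (fun _ => {CPInfty.base}) := by
    intro e
    obtain ⟨σ, hσ, h⟩ := exists_simplex_expandConfig_one (simplexRadius_stableOutside_pos e)
    refine mem_polyhedralProduct_iff.mpr ⟨σ, hσ, fun i hi => ?_⟩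
    rw [toCPInfty, CPInfty.ofConfig_eq_base_iff, interiorPart_stableOutside, hH]
    exact h i hi
  have hH1 : Continuous fun e => H (e, 1) := hHc.comp (Continuous.prodMk_left 1)
  let f : C(StableRelConfTuple K ClosedDisc discBoundary D, DavisJanuszkiewicz K) :=
    ⟨fun e => ⟨_, hmem e⟩, (continuous_toCPInfty.comp hH1).subtype_mk _⟩
  have hself : ∀ e t, expansionRadius K (stableOutside e) t = 1 → H (e, t) = e := by
    intro e t h
    refine stableOutside_injective (funext fun i => ?_)
    rw [hH, expandConfig_eq_self h, interiorPart_stableOutside]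
  have hgf : ∀ e, g (f e) = H (e, 1) := fun e => toCPInfty_injective (hg _)
  have hfg : ∀ p, f (g p) = p := by
    intro p
    refine Subtype.ext ?_
    change toCPInfty (H (g p, 1)) = p.1
    rw [hself, hg]
    obtain ⟨σ, hσ, h⟩ := mem_polyhedralProduct_iff.mp p.2
    have h1 : simplexRadius K (stableOutside (g p)) = 1 := by
      refine simplexRadius_eq_one hlow hσ fun i hi => ?_
      rw [← interiorPart_stableOutside, ← CPInfty.ofConfig_eq_base_iff, ← h i hi, ← hg]
      rfl
    simp [expansionRadius, h1]
  refine ⟨⟨f, ⟨g, hgc⟩, ⟨ContinuousMap.Homotopy.symm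
    { toFun := fun p => H (p.2, p.1)
      continuous_toFun := hHc.comp continuous_swap
      map_zero_left := fun e => hself e 0 (by simp [expansionRadius])
      map_one_left := fun e => (hgf e).symm }⟩, ?_⟩⟩
  have h : f.comp ⟨g, hgc⟩ = ContinuousMap.id _ := ContinuousMap.ext hfg
  rw [h]

end

/-! ### Fans -/

/-- A rational cone with a primitive generator `ν` is spanned by `ν`, as its lattice points are
multiples of `ν`. -/
theorem latticeCone_singleton_mem_cones {n r : ℕ} (F : ConeFan n) {ν : Fin r → Fin n → ℤ}
    {k : Fin r} {ρ : PointedCone ℝ (Fin n → ℝ)} (hρ : ρ ∈ F.cones)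
    (hν : IsPrimitiveGenerator (ν k) ρ) : latticeCone ν {k} ∈ F.cones := by
  suffices h : latticeCone ν {k} = ρ by rwa [h]
  obtain ⟨S, hS⟩ := F.rational ρ hρ
  apply le_antisymm
  · refine Submodule.span_le.mpr ?_
    rintro _ ⟨i, hi, rfl⟩
    rw [Finset.coe_singleton, mem_singleton_iff] at hi
    subst hi
    exact (hν _).mpr ⟨1, (one_smul _ _).symm⟩
  · have hgen : latticeVec (ν k) ∈ latticeCone ν {k} :=
      Submodule.subset_span ⟨k, by simp, rfl⟩
    have hle : latticeCone id S ≤ latticeCone ν {k} := by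
      refine Submodule.span_le.mpr ?_
      rintro _ ⟨m, hm, rfl⟩
      have hmρ : latticeVec m ∈ ρ := by
        rw [hS]
        exact Submodule.subset_span ⟨m, hm, rfl⟩
      obtain ⟨j, rfl⟩ := (hν m).mp hmρ
      have h1 : latticeVec (id (j • ν k)) = j • latticeVec (ν k) := by
        funext l
        simp [latticeVec]
      change latticeVec (id (j • ν k)) ∈ latticeCone ν {k}
      rw [h1]
      exact nsmul_mem hgen j
    exact hS.le.trans hle

theorem lemma3p3 {n r : ℕ} (F : ConeFan n) (hF : {⊥} ⊂ F.cones)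
    (ρ : Fin r → PointedCone ℝ (Fin n → ℝ)) (hρ_inj : Function.Injective ρ)
    (hρ : Set.range ρ = F.rays)
    (ν : Fin r → Fin n → ℤ) (hν : ∀ k, IsPrimitiveGenerator (ν k) (ρ k))
    (D : Fin r → ℕ) (hD : ∀ k, 1 ≤ D k) :
    Nonempty (ContinuousMap.HomotopyEquiv
      (StableRelConfTuple (F.underlyingComplex ν) ClosedDisc discBoundary D)
      (DavisJanuszkiewicz (F.underlyingComplex ν))) := by
  refine nonempty_homotopyEquiv_davisJanuszkiewicz (F.isLowerSet_underlyingComplex ν) fun k => ?_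
  have hk : ρ k ∈ F.rays := hρ ▸ mem_range_self k
  exact ⟨{k}, Finset.Subset.refl _, latticeCone_singleton_mem_cones F hk.1 (hν k)⟩
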